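/- **Setting.** A *3-triangulation* $T$ is a closed connected complex obtained from finitely many (at least one) oriented tetrahedra by gluing all their triangles in pairs by orientation-reversing simplicial bijections, no triangle being glued to itself and no edge being identified with its own reverse; no identifications are made beyond those generated by the gluings. A simplex may occur several times in the boundary of another one. The *dual graph* is the multigraph whose vertices are the tetrahedra and whose edges are the triangles of $T$. A *tree of tetrahedra* is a partial gluing of the tetrahedra whose dual graph is a tree. **Morse gradients.** A *discrete vector field* on $T$ is a collection $\mathcal L$ of pairwise disjoint ordered pairs $(\eta,\eta')$, where $\eta$ is a $k$-simplex contained in the $(k+1)$-simplex $\eta'$; one says that $\eta$ is oriented towards $\eta'$. Simplices in no pair are *critical*. A walk may go from $\eta$ to $\eta'$ if $(\eta,\eta')\in\mathcal L$, and from a simplex $\eta'$ to a codimension-one face $\eta$ of it if $(\eta,\eta')\notin\mathcal L$ or if $\eta$ occurs more than once in the boundary of $\eta'$. A *Morse gradient* is a discrete vector field with no closed walk of positive length. Two Morse gradients are *related by re-pointing* if they have the same set of edges towards which a vertex is oriented, the same set of triangles that are oriented towards a tetrahedron, and the same pairs (edge, triangle); that is, they differ only in the positions of the critical vertices and tetrahedra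 inside these two forests. **Local constructions.** A *local construction* of $T$ is a sequence $T_0,T_1,\dots,T_n=T$ of (partial) gluings of the tetrahedra of $T$, together with a choice at every step $s$ of an edge, such that $T_0$ is a tree of tetrahedra and, for $1\le s\le n$, $T_s$ is obtained from $T_{s-1}$ by gluing two distinct boundary triangles of $T_{s-1}$ that share the chosen edge, by a map which fixes that edge. Let $\Sigma_s$ be the triangle of $T$ resulting from the gluing at step $s$, and $\sigma_s$ the image in $T$ of the chosen edge. The local construction is *based on* $T_0$, and its *critical tree* $E$ is the set of edges of $T$ other than $\sigma_1,\dots,\sigma_n$. Two local constructions of $T$ are *weakly equivalent* if they are based on the same tree of tetrahedra $T_0$ and have the same critical tree $E$. **Proposition.** Let $T$ be a 3-triangulation. There is a bijection between - Morse gradients on $T$ with exactly two critical simplices, up to re-pointing, and - local constructions of $T$, up to weak equivalence. Under this bijection the class of a Morse gradient $\mathcal L$ corresponds to the class of a local construction based on $T_0$ with critical tree $E$ if and only if the triangles oriented towards a tetrahedron in $\mathcal L$ are exactly the triangles of $T$ interior to $T_0$ and the edges towards which a vertex is oriented in $\mathcal L$ are exactly the edges of $E$. In that case the pairs of $\mathcal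 L$ formed by an edge and a triangle are exactly the pairs $(\sigma_s,\Sigma_s)$, $1\le s\le n$. -/

import Mathlib

/-- A (possibly partial) facewise gluing of a family of labelled tetrahedra indexed by `τ`, the
vertices of each tetrahedron being labelled by `Fin 4`.  The triangle of the tetrahedron `t` that is
opposite to its vertex `i` is written `(t, i)`.
`glue t i = none` means that `(t, i)` is a boundary triangle; `glue t i = some (u, p)` means that
`(t, i)` is glued to the triangle `(u, p i)`, the vertex `v ≠ i` of `t` being identified with the
vertex `p v` of `u`.  No triangle is glued to itself. -/
@[ext]
structure Gluing (τ : Type*) where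
  glue : τ → Fin 4 → Option (τ × Equiv.Perm (Fin 4))
  glue_symm : ∀ t i u p, glue t i = some (u, p) → glue u (p i) = some (t, p⁻¹)
  glue_ne : ∀ t i u p, glue t i = some (u, p) → (u, p i) ≠ (t, i)

namespace Gluing

variable {τ : Type*}

/-- A nonempty face of one of the (unglued) labelled tetrahedra: a tetrahedron and a nonempty set
of its vertices. -/
abbrev Face (τ : Type*) := τ × {S : Finset (Fin 4) // S.Nonempty}

/-- The face of the triangle `(t, i)` spanned by the vertex set `S` is identified with its image
under the gluing of `(t, i)`. -/
def FaceIdent (G : Gluing τ) (x y : Face τ) : Prop :=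
  ∃ i p, G.glue x.1 i = some (y.1, p) ∧ i ∉ x.2.1 ∧ y.2.1 = x.2.1.map p.toEmbedding

/-- The simplices of the glued complex: classes of faces of the tetrahedra. -/
def Simplex (G : Gluing τ) : Type _ := Quot G.FaceIdent

/-- The simplex of the glued complex that is the image of a face. -/
def toSimplex (G : Gluing τ) (x : Face τ) : G.Simplex := Quot.mk _ x

/-- The dimension of a simplex. -/
def Simplex.dim {G : Gluing τ} : G.Simplex → ℕ :=
  Quot.lift (fun x => x.2.1.card - 1) (by
    rintro x y ⟨i, p, -, -, h⟩
    simp [h])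

/-- The edge of the glued complex that is the image of the edge `{a, b}` of `t`. -/
def mkEdge (G : Gluing τ) (t : τ) (a b : Fin 4) : G.Simplex :=
  G.toSimplex (t, ⟨{a, b}, by simp⟩)

/-- The triangle of the glued complex that is the image of the triangle `(t, i)`. -/
def mkTriangle (G : Gluing τ) (t : τ) (i : Fin 4) : G.Simplex :=
  G.toSimplex (t, ⟨{i}ᶜ, by revert i; decide⟩)

/-- Elementary identification of directed edges `(t, a, b)`, from vertex `a` to vertex `b` of `t`,
through a single glued triangle. -/
def DirEdgeIdent (G : Gluing τ) (x y : τ × Fin 4 × Fin 4) : Prop :=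
  ∃ i p, G.glue x.1 i = some (y.1, p) ∧ i ≠ x.2.1 ∧ i ≠ x.2.2 ∧
    y.2.1 = p x.2.1 ∧ y.2.2 = p x.2.2

/-- Two directed edges of the tetrahedra have the same image, as directed edges, in the glued
complex. -/
def SameDirEdge (G : Gluing τ) : τ × Fin 4 × Fin 4 → τ × Fin 4 × Fin 4 → Prop :=
  Relation.EqvGen G.DirEdgeIdent

/-- Adjacency in the dual graph, forgetting loops and multiplicities. -/
def dualGraph (G : Gluing τ) : SimpleGraph τ where
  Adj t u := t ≠ u ∧ ∃ i p, G.glue t i = some (u, p)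
  symm := ⟨fun t u h => by
    obtain ⟨hne, i, p, hg⟩ := h
    exact ⟨hne.symm, p i, p⁻¹, G.glue_symm _ _ _ _ hg⟩⟩
  loopless := ⟨fun t h => h.1 rfl⟩

/-- A closed, connected, oriented, non-degenerate three-dimensional triangulation.
Non-degeneracy says that no edge is identified with itself in the reverse direction. -/
structure IsClosedTriangulation (G : Gluing τ) : Prop where
  closed : ∀ t i, G.glue t i ≠ none
  connected : G.dualGraph.Connected
  oriented : ∃ o : τ → ℤˣ, ∀ t i u p, G.glue t i = some (u, p) →
    Equiv.Perm.sign p = - (o t * o u)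
  nondegenerate : ∀ t a b, a ≠ b → ¬ G.SameDirEdge (t, a, b) (t, b, a)

/-- A tree of tetrahedra: the dual graph, which is a multigraph, is a tree; that is, it has neither
loops nor multiple edges and the underlying simple graph is a tree. -/
structure IsTreeOfTetrahedra (G : Gluing τ) : Prop where
  isTree : G.dualGraph.IsTree
  no_loop : ∀ t i p, G.glue t i ≠ some (t, p)
  no_multi : ∀ t u i j p q, G.glue t i = some (u, p) → G.glue t j = some (u, q) → i = j

/-! ### Discrete vector fields -/

/-- `η` is a codimension-one face of `η'`. -/
def IsFacetOf (G : Gluing τ) (η η' : G.Simplex) : Prop :=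
  ∃ (t : τ) (S S' : {S : Finset (Fin 4) // S.Nonempty}), S'.1 ⊆ S.1 ∧
    S.1.card = S'.1.card + 1 ∧ G.toSimplex (t, S') = η ∧ G.toSimplex (t, S) = η'

/-- A discrete vector field, as a collection of disjoint pairs `(η, η')` where `η` is oriented
towards `η'`. -/
structure DiscreteVectorField (G : Gluing τ) where
  pairs : Set (G.Simplex × G.Simplex)
  isFacetOf : ∀ η η', (η, η') ∈ pairs → G.IsFacetOf η η'
  disjoint : ∀ a b c d, (a, b) ∈ pairs → (c, d) ∈ pairs →
    (a = c ∨ a = d ∨ b = c ∨ b = d) → a = c ∧ b = d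

namespace DiscreteVectorField

variable {G : Gluing τ}

/-- The critical simplices: those that occur in no pair. -/
def critical (V : G.DiscreteVectorField) : Set G.Simplex :=
  {η | ∀ a b, (a, b) ∈ V.pairs → η ≠ a ∧ η ≠ b}

/-- A step downwards from `η'` to a codimension-one face `η`, through one occurrence of `η` in the
boundary of `η'`.  If `η` is oriented towards `η'`, then one occurrence of `η` is used up by that
orientation, and the step is allowed only through another one. -/
def StepDown (V : G.DiscreteVectorField) (η' η : G.Simplex) : Prop :=
  ∃ (t : τ) (S S' : {S : Finset (Fin 4) // S.Nonempty}), S'.1 ⊆ S.1 ∧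
    S.1.card = S'.1.card + 1 ∧ G.toSimplex (t, S') = η ∧ G.toSimplex (t, S) = η' ∧
    ((η, η') ∈ V.pairs → ∃ S'' : {S : Finset (Fin 4) // S.Nonempty}, S''.1 ⊆ S.1 ∧ S'' ≠ S' ∧
      G.toSimplex (t, S'') = η)

/-- One step of a walk. -/
def Step (V : G.DiscreteVectorField) (η η' : G.Simplex) : Prop :=
  (η, η') ∈ V.pairs ∨ V.StepDown η η'

/-- There is no closed walk with at least one step. -/
def IsAcyclic (V : G.DiscreteVectorField) : Prop :=
  ∀ η, ¬ Relation.TransGen V.Step η η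

/-- The edges that have a vertex oriented towards them. -/
def edgeForest (V : G.DiscreteVectorField) : Set G.Simplex :=
  {e | e.dim = 1 ∧ ∃ v, (v, e) ∈ V.pairs}

/-- The triangles that are oriented towards a tetrahedron: the edges of the distinguished forest of
the dual graph. -/
def dualForest (V : G.DiscreteVectorField) : Set G.Simplex :=
  {f | f.dim = 2 ∧ ∃ t, (f, t) ∈ V.pairs}

/-- The pairs of an edge oriented towards a triangle. -/
def middlePairs (V : G.DiscreteVectorField) : Set (G.Simplex × G.Simplex) :=
  {x | x ∈ V.pairs ∧ x.1.dim = 1}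

end DiscreteVectorField

/-- The Morse gradients (acyclic discrete vector fields) with exactly two critical simplices. -/
def TwoCriticalMorseGradient (G : Gluing τ) :=
  {V : G.DiscreteVectorField // V.IsAcyclic ∧ V.critical.ncard = 2}

/-- Re-pointing: the two gradients have the same forest in the 1-skeleton, the same forest in the
dual graph and the same pairs of an edge and a triangle, so that only the positions of the critical
simplices within the two forests may differ. -/
def repointing (G : Gluing τ) : Setoid G.TwoCriticalMorseGradient where
  r V W := V.1.edgeForest = W.1.edgeForest ∧ V.1.dualForest = W.1.dualForest ∧
    V.1.middlePairs = W.1.middlePairs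
  iseqv :=
    ⟨fun _ => ⟨rfl, rfl, rfl⟩, fun h => ⟨h.1.symm, h.2.1.symm, h.2.2.symm⟩,
      fun h k => ⟨h.1.trans k.1, h.2.1.trans k.2.1, h.2.2.trans k.2.2⟩⟩

/-! ### Local constructions -/

/-- The data of one gluing move: the triangle `(tet₁, facet)` is glued to the triangle
`(tet₂, perm facet)` through `perm`, the chosen common edge being the image of the edge from `a`
to `b` of `tet₁`. -/
structure Move (τ : Type*) where
  tet₁ : τ
  facet : Fin 4
  tet₂ : τ
  perm : Equiv.Perm (Fin 4)
  a : Fin 4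
  b : Fin 4

/-- The move `m` is allowed in `G`: it concerns two distinct boundary triangles, and the chosen edge
of the first one is, already in `G`, identified with the edge of the second one to which the move
sends it. In other words the chosen edge is shared by the two triangles, and the gluing map fixes
it. -/
structure IsAllowed (G : Gluing τ) (m : Move τ) : Prop where
  boundary₁ : G.glue m.tet₁ m.facet = none
  boundary₂ : G.glue m.tet₂ (m.perm m.facet) = none
  distinct : (m.tet₁, m.facet) ≠ (m.tet₂, m.perm m.facet)
  a_ne_b : m.a ≠ m.b
  a_ne_facet : m.a ≠ m.facet
  b_ne_facet : m.b ≠ m.facet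
  shared : G.SameDirEdge (m.tet₁, m.a, m.b) (m.tet₂, m.perm m.a, m.perm m.b)

/-- `G'` is obtained from `G` by performing the move `m`, and nothing else. -/
structure IsResult (G : Gluing τ) (m : Move τ) (G' : Gluing τ) : Prop where
  glued : G'.glue m.tet₁ m.facet = some (m.tet₂, m.perm)
  unchanged : ∀ t i, (t, i) ≠ (m.tet₁, m.facet) → (t, i) ≠ (m.tet₂, m.perm m.facet) →
    G'.glue t i = G.glue t i

/-- A local construction of `T`: starting from a tree of tetrahedra, one repeatedly glues two
boundary triangles that share a chosen edge, until `T` is reached. -/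
structure LocalConstruction (T : Gluing τ) where
  numSteps : ℕ
  stage : Fin (numSteps + 1) → Gluing τ
  move : Fin numSteps → Move τ
  base_tree : (stage 0).IsTreeOfTetrahedra
  allowed : ∀ s, (stage s.castSucc).IsAllowed (move s)
  result : ∀ s, (stage s.castSucc).IsResult (move s) (stage s.succ)
  final : stage (Fin.last numSteps) = T

namespace LocalConstruction

variable {T : Gluing τ}

/-- The tree of tetrahedra on which the construction is based. -/
def base (c : T.LocalConstruction) : Gluing τ := c.stage 0

/-- The triangles of `T` that are interior to the tree of tetrahedra on which the construction is
based. -/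
def baseTriangles (c : T.LocalConstruction) : Set T.Simplex :=
  {f | ∃ t i, c.base.glue t i ≠ none ∧ f = T.mkTriangle t i}

/-- The edge of `T` chosen at step `s`. -/
def chosenEdge (c : T.LocalConstruction) (s : Fin c.numSteps) : T.Simplex :=
  T.mkEdge (c.move s).tet₁ (c.move s).a (c.move s).b

/-- The triangle of `T` that results from the gluing at step `s`. -/
def chosenTriangle (c : T.LocalConstruction) (s : Fin c.numSteps) : T.Simplex :=
  T.mkTriangle (c.move s).tet₁ (c.move s).facet

/-- The critical tree: the edges of `T` that are left when the chosen edges and the triangles have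
been collapsed, that is, the edges that are never chosen. -/
def criticalTree (c : T.LocalConstruction) : Set T.Simplex :=
  {e | e.dim = 1 ∧ ∀ s, c.chosenEdge s ≠ e}

end LocalConstruction

/-- Weak equivalence of local constructions of `T`: same tree of tetrahedra, same critical tree. -/
def weakEquivalence (T : Gluing τ) : Setoid T.LocalConstruction where
  r c d := c.base = d.base ∧ c.criticalTree = d.criticalTree
  iseqv :=
    ⟨fun _ => ⟨rfl, rfl⟩, fun h => ⟨h.1.symm, h.2.symm⟩,
      fun h k => ⟨h.1.trans k.1, h.2.trans k.2⟩⟩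

end Gluing

/-! Let a gradient with exactly two critical simplices be given. As there is no closed walk, some
tetrahedron is reached from no other tetrahedron and some vertex leads to no other vertex; these two
are critical, and everything else is paired. The triangles paired with tetrahedra then form a
spanning tree of the dual graph, that is, a tree of tetrahedra T₀, and every other triangle Σ is
paired with an edge σ. A triangle around σ other than Σ reaches Σ by a walk through σ. Hence, if the
triangles are glued in an order compatible with the walks, then all other triangles around σ are
glued before Σ. A parity count in the link of σ shows that the two sides of Σ already share σ
(`sameDirEdge_of_boundary`), so that the gluing is an allowed move.

Conversely, in any partial gluing the link of an edge is connected and has at most two boundary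
points (`boundary_edgeFlags`), so the move at σ_s completes the link of σ_s. Therefore σ_s lies in
no triangle glued later and occurs only once in Σ_s (`le_of_chosenEdge`, `pair_eq_of_chosenEdge`).
This triangular incidence has three consequences: the pairs (σ_s, Σ_s) create no closed walk; they
are the only matching compatible with the two forests (`middlePairs_eq`); and each σ_s can be
bypassed along the other two sides of Σ_s, which are critical or chosen later, so that the edges of
E connect all vertices (`criticalTree_connected`).

That E has no superfluous edge is a count. It amounts to v − e + f − N ≥ 0, where v, e, f, N are the
numbers of vertices, edges, triangles and tetrahedra, with f = 2N. This is `card_edges_le`, a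
tree–cotree argument in the vertex links. So E is a spanning tree of the vertices. Rooting E and T₀
and pairing each non-root vertex or tetrahedron with the simplex leading to its parent completes the
pairs (σ_s, Σ_s) to a gradient, shown to be acyclic by an explicit Morse function
(`exists_gradient`). -/

namespace Gluing

open Finset Relation

variable {τ : Type*}

/-- The vertex of the glued complex that is the image of the vertex `a` of `t`. -/
def vert (G : Gluing τ) (t : τ) (a : Fin 4) : G.Simplex :=
  G.toSimplex (t, ⟨{a}, by simp⟩)

/-- The tetrahedron of the glued complex that is the image of `t`. -/
def tet (G : Gluing τ) (t : τ) : G.Simplex :=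
  G.toSimplex (t, ⟨univ, by simp⟩)

/-- Elementary identification of vertices `(t, a)` of the tetrahedra. -/
def CornerIdent (G : Gluing τ) (x y : τ × Fin 4) : Prop :=
  ∃ i p, G.glue x.1 i = some (y.1, p) ∧ i ≠ x.2 ∧ y.2 = p x.2

lemma pair_eq_pair {a b c d : Fin 4} (h : ({a, b} : Finset (Fin 4)) = {c, d}) :
    (c = a ∧ d = b) ∨ (c = b ∧ d = a) := by
  revert a b c d; decide

lemma card_compl_pt (i : Fin 4) : ({i}ᶜ : Finset (Fin 4)).card = 3 := by
  revert i; decide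

lemma compl_pt_nonempty (i : Fin 4) : ({i}ᶜ : Finset (Fin 4)).Nonempty := by
  revert i; decide

lemma eq_compl_pt {S : Finset (Fin 4)} (h : S.card = 3) : ∃ i, S = {i}ᶜ := by
  revert S; decide

lemma eq_univ_of_card4 {S : Finset (Fin 4)} (h : S.card = 4) : S = univ := by
  revert S; decide

/-! ### Simplices of the glued complex in coordinates -/

section Basic

variable {G : Gluing τ}

lemma FaceIdent.symm {x y : Face τ} (h : G.FaceIdent x y) : G.FaceIdent y x := by
  obtain ⟨i, p, hg, hi, hS⟩ := h
  refine ⟨p i, p⁻¹, G.glue_symm _ _ _ _ hg, ?_, ?_⟩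
  · rw [hS]; simpa using hi
  · rw [hS, Finset.map_map]
    ext z; simp

/-- A set attached to faces that grows under identifications is an invariant of simplices. -/
lemma eq_of_toSimplex_eq {β : Type*} {f : Face τ → Set β}
    (hf : ∀ x y, G.FaceIdent x y → f x ⊆ f y) {x y : Face τ}
    (h : G.toSimplex x = G.toSimplex y) : f x = f y :=
  congrArg (Quot.lift f fun x y hxy => (hf x y hxy).antisymm (hf y x hxy.symm)) h

lemma card_eq_of_toSimplex_eq {x y : Face τ} (h : G.toSimplex x = G.toSimplex y) :
    x.2.1.card = y.2.1.card :=
  congrArg (Quot.lift (fun x : Face τ => x.2.1.card)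
    (by rintro x y ⟨i, p, -, -, h⟩; simp [h])) h

lemma mkEdge_comm (t : τ) (a b : Fin 4) : G.mkEdge t a b = G.mkEdge t b a := by
  unfold mkEdge; congr 3; exact Finset.pair_comm a b

lemma vert_glue {t : τ} {i : Fin 4} {u : τ} {p : Equiv.Perm (Fin 4)}
    (h : G.glue t i = some (u, p)) {a : Fin 4} (ha : i ≠ a) : G.vert t a = G.vert u (p a) :=
  Quot.sound ⟨i, p, h, by simpa using ha, by simp⟩

lemma mkEdge_glue {t : τ} {i : Fin 4} {u : τ} {p : Equiv.Perm (Fin 4)}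
    (h : G.glue t i = some (u, p)) {a b : Fin 4} (ha : i ≠ a) (hb : i ≠ b) :
    G.mkEdge t a b = G.mkEdge u (p a) (p b) :=
  Quot.sound ⟨i, p, h, by simp [ha, hb], by simp [Finset.map_insert]⟩

lemma mkTriangle_glue {t : τ} {i : Fin 4} {u : τ} {p : Equiv.Perm (Fin 4)}
    (h : G.glue t i = some (u, p)) : G.mkTriangle t i = G.mkTriangle u (p i) :=
  Quot.sound ⟨i, p, h, by simp, by
    ext z
    simp only [mem_compl, mem_singleton, mem_map_equiv]
    rw [Equiv.symm_apply_eq]⟩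

/-- A face identification leaves out the vertex opposite the glued triangle, so it never applies to
a whole tetrahedron. -/
lemma tet_injective : Function.Injective G.tet := by
  intro t u h
  have := eq_of_toSimplex_eq (G := G) (f := fun x => {z | x.2.1 = univ ∧ z = x.1}) (by
    rintro x y ⟨i, p, -, hi, -⟩ z ⟨hz, -⟩
    simp [hz] at hi) h
  have hu : u ∈ ({z | (univ : Finset (Fin 4)) = univ ∧ z = u} : Set τ) := ⟨rfl, rfl⟩
  rw [← this] at hu
  exact hu.2.symm

/-- The only triangle carried along by the gluing of `(t, i)` is `(t, i)` itself, so a class of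
triangles consists of one triangle and its partner, if any. The invariant attached to a face is this
class. -/
lemma mkTriangle_eq_iff {t u : τ} {i j : Fin 4} :
    G.mkTriangle t i = G.mkTriangle u j ↔
      (u = t ∧ j = i) ∨ ∃ p, G.glue t i = some (u, p) ∧ j = p i := by
  constructor
  · intro h
    have := eq_of_toSimplex_eq (G := G)
      (f := fun x => {z : τ × Fin 4 | ∃ i, x.2.1 = {i}ᶜ ∧
        ((z.1 = x.1 ∧ z.2 = i) ∨ ∃ p, G.glue x.1 i = some (z.1, p) ∧ z.2 = p i)}) (by
      rintro ⟨t, S⟩ ⟨u, S'⟩ ⟨k, p, hg, hk, hS⟩ ⟨v, j⟩ ⟨i, hi, h⟩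
      dsimp only at *
      have hki : k = i := by rw [hi] at hk; simpa using hk
      subst hki
      refine ⟨p k, ?_, ?_⟩
      · rw [hS, hi]; ext z
        simp only [mem_compl, mem_singleton, mem_map_equiv]
        rw [Equiv.symm_apply_eq]
      · rcases h with ⟨rfl, rfl⟩ | ⟨q, hq, rfl⟩
        · exact Or.inr ⟨p⁻¹, G.glue_symm _ _ _ _ hg, by simp⟩
        · rw [hg] at hq
          obtain ⟨rfl, rfl⟩ := Prod.mk.inj (Option.some.inj hq)
          exact Or.inl ⟨rfl, rfl⟩) h
    have hu : (u, j) ∈ ({z : τ × Fin 4 | ∃ i, ({j}ᶜ : Finset (Fin 4)) = {i}ᶜ ∧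
        ((z.1 = u ∧ z.2 = i) ∨ ∃ p, G.glue u i = some (z.1, p) ∧ z.2 = p i)} : Set _) :=
      ⟨j, rfl, Or.inl ⟨rfl, rfl⟩⟩
    rw [← this] at hu
    obtain ⟨k, hk, h⟩ := hu
    have : i = k := by simpa using hk
    subst this
    exact h
  · rintro (⟨rfl, rfl⟩ | ⟨p, hp, rfl⟩)
    · rfl
    · exact mkTriangle_glue hp

lemma SameDirEdge.mkEdge_eq {x y : τ × Fin 4 × Fin 4} (h : G.SameDirEdge x y) :
    G.mkEdge x.1 x.2.1 x.2.2 = G.mkEdge y.1 y.2.1 y.2.2 := by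
  induction h with
  | rel x y h =>
    obtain ⟨i, p, hg, ha, hb, h1, h2⟩ := h
    rw [h1, h2]; exact mkEdge_glue hg ha hb
  | refl x => rfl
  | symm x y _ ih => exact ih.symm
  | trans x y z _ _ ih1 ih2 => exact ih1.trans ih2

lemma SameDirEdge.vert_eq {x y : τ × Fin 4 × Fin 4} (h : G.SameDirEdge x y) :
    G.vert x.1 x.2.1 = G.vert y.1 y.2.1 ∧ G.vert x.1 x.2.2 = G.vert y.1 y.2.2 := by
  induction h with
  | rel x y h =>
    obtain ⟨i, p, hg, ha, hb, h1, h2⟩ := h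
    rw [h1, h2]; exact ⟨vert_glue hg ha, vert_glue hg hb⟩
  | refl x => exact ⟨rfl, rfl⟩
  | symm x y _ ih => exact ⟨ih.1.symm, ih.2.symm⟩
  | trans x y z _ _ ih1 ih2 => exact ⟨ih1.1.trans ih2.1, ih1.2.trans ih2.2⟩

lemma SameDirEdge.swap {x y : τ × Fin 4 × Fin 4} (h : G.SameDirEdge x y) :
    G.SameDirEdge (x.1, x.2.2, x.2.1) (y.1, y.2.2, y.2.1) := by
  induction h with
  | rel x y h =>
    obtain ⟨i, p, hg, ha, hb, h1, h2⟩ := h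
    exact EqvGen.rel _ _ ⟨i, p, hg, hb, ha, h2, h1⟩
  | refl x => exact EqvGen.refl _
  | symm x y _ ih => exact EqvGen.symm _ _ ih
  | trans x y z _ _ ih1 ih2 => exact EqvGen.trans _ _ _ ih1 ih2

lemma SameDirEdge.ne_iff {x y : τ × Fin 4 × Fin 4} (h : G.SameDirEdge x y) :
    x.2.1 ≠ x.2.2 ↔ y.2.1 ≠ y.2.2 := by
  induction h with
  | rel x y h =>
    obtain ⟨i, p, hg, ha, hb, h1, h2⟩ := h
    rw [h1, h2]; simp
  | refl x => rfl
  | symm x y _ ih => exact ih.symm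
  | trans x y z _ _ ih1 ih2 => exact ih1.trans ih2

/-- Every identification of edges as vertex sets lifts to an identification of directed edges; only
the direction at the start is left open. -/
lemma sameDirEdge_of_mkEdge_eq {t u : τ} {a b c d : Fin 4}
    (h : G.mkEdge t a b = G.mkEdge u c d) :
    G.SameDirEdge (t, a, b) (u, c, d) ∨ G.SameDirEdge (t, b, a) (u, c, d) := by
  have := eq_of_toSimplex_eq (G := G)
    (f := fun x => {z : τ × Fin 4 × Fin 4 | ∃ a b, x.2.1 = {a, b} ∧
      G.SameDirEdge (x.1, a, b) z}) (by
    rintro ⟨t, S⟩ ⟨u, S'⟩ ⟨k, p, hg, hk, hS⟩ z ⟨a, b, hab, h⟩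
    dsimp only at *
    rw [hab] at hk
    simp only [mem_insert, mem_singleton, not_or] at hk
    refine ⟨p a, p b, by rw [hS, hab]; simp [Finset.map_insert], ?_⟩
    exact EqvGen.trans _ _ _
      (EqvGen.symm _ _ (EqvGen.rel _ _ ⟨k, p, hg, hk.1, hk.2, rfl, rfl⟩)) h) h
  have hu : (u, c, d) ∈ ({z : τ × Fin 4 × Fin 4 | ∃ a b, ({c, d} : Finset (Fin 4)) = {a, b} ∧
      G.SameDirEdge (u, a, b) z} : Set _) := ⟨c, d, rfl, EqvGen.refl _⟩
  rw [← this] at hu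
  obtain ⟨a', b', h1, h2⟩ := hu
  rcases pair_eq_pair h1 with ⟨rfl, rfl⟩ | ⟨rfl, rfl⟩
  · exact Or.inl h2
  · exact Or.inr h2

lemma mkEdge_verts {t u : τ} {a b c d : Fin 4} (h : G.mkEdge t a b = G.mkEdge u c d) :
    (G.vert t a = G.vert u c ∧ G.vert t b = G.vert u d) ∨
      (G.vert t a = G.vert u d ∧ G.vert t b = G.vert u c) := by
  rcases sameDirEdge_of_mkEdge_eq h with h | h
  · exact Or.inl h.vert_eq
  · exact Or.inr h.vert_eq.symm

lemma cornerIdent_of_vert_eq {t u : τ} {a b : Fin 4} (h : G.vert t a = G.vert u b) :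
    EqvGen G.CornerIdent (t, a) (u, b) := by
  have := eq_of_toSimplex_eq (G := G)
    (f := fun x => {z : τ × Fin 4 | ∃ a, x.2.1 = {a} ∧
      EqvGen G.CornerIdent (x.1, a) z}) (by
    rintro ⟨t, S⟩ ⟨u, S'⟩ ⟨k, p, hg, hk, hS⟩ z ⟨a, ha, h⟩
    dsimp only at *
    rw [ha] at hk
    refine ⟨p a, by rw [hS, ha]; simp, ?_⟩
    exact EqvGen.trans _ _ _
      (EqvGen.symm _ _ (EqvGen.rel _ _ ⟨k, p, hg, by simpa using hk, rfl⟩)) h) h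
  have hu : (u, b) ∈ ({z : τ × Fin 4 | ∃ a, ({b} : Finset (Fin 4)) = {a} ∧
      EqvGen G.CornerIdent (u, a) z} : Set _) := ⟨b, rfl, EqvGen.refl _⟩
  rw [← this] at hu
  obtain ⟨a', h1, h2⟩ := hu
  obtain rfl : a = a' := by simpa using h1
  exact h2

/-! ### Dimensions -/

@[simp] lemma dim_vert (t : τ) (a : Fin 4) : (G.vert t a).dim = 0 := rfl

@[simp] lemma dim_tet (t : τ) : (G.tet t).dim = 3 := rfl

@[simp] lemma dim_mkTriangle (t : τ) (i : Fin 4) : (G.mkTriangle t i).dim = 2 := by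
  change ({i}ᶜ : Finset (Fin 4)).card - 1 = 2
  rw [card_compl_pt]

lemma dim_mkEdge (t : τ) {a b : Fin 4} (h : a ≠ b) : (G.mkEdge t a b).dim = 1 := by
  change ({a, b} : Finset (Fin 4)).card - 1 = 1
  rw [card_pair h]

lemma dim_toSimplex (x : Face τ) : (G.toSimplex x).dim + 1 = x.2.1.card := by
  have : 0 < x.2.1.card := card_pos.2 x.2.2
  change x.2.1.card - 1 + 1 = _
  omega

lemma toSimplex_surj (x : G.Simplex) : ∃ y, G.toSimplex y = x := Quot.exists_rep x

lemma toSimplex_cases (t : τ) (S : {S : Finset (Fin 4) // S.Nonempty}) :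
    (∃ a, S.1 = {a} ∧ G.toSimplex (t, S) = G.vert t a) ∨
    (∃ a b, a ≠ b ∧ S.1 = {a, b} ∧ G.toSimplex (t, S) = G.mkEdge t a b) ∨
    (∃ i, S.1 = {i}ᶜ ∧ G.toSimplex (t, S) = G.mkTriangle t i) ∨
    (S.1 = univ ∧ G.toSimplex (t, S) = G.tet t) := by
  obtain ⟨S, hS⟩ := S
  have h1 : 0 < S.card := card_pos.2 hS
  have h4 : S.card ≤ 4 := S.card_le_univ
  have : S.card = 1 ∨ S.card = 2 ∨ S.card = 3 ∨ S.card = 4 := by omega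
  rcases this with h | h | h | h
  · obtain ⟨a, rfl⟩ := card_eq_one.1 h
    exact Or.inl ⟨a, rfl, rfl⟩
  · obtain ⟨a, b, hab, rfl⟩ := card_eq_two.1 h
    exact Or.inr (Or.inl ⟨a, b, hab, rfl, rfl⟩)
  · obtain ⟨i, rfl⟩ := eq_compl_pt h
    exact Or.inr (Or.inr (Or.inl ⟨i, rfl, rfl⟩))
  · obtain rfl := eq_univ_of_card4 h
    exact Or.inr (Or.inr (Or.inr ⟨rfl, rfl⟩))

lemma simplex_cases (x : G.Simplex) :
    (∃ t a, x = G.vert t a) ∨ (∃ t a b, a ≠ b ∧ x = G.mkEdge t a b) ∨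
      (∃ t i, x = G.mkTriangle t i) ∨ ∃ t, x = G.tet t := by
  obtain ⟨⟨t, S⟩, rfl⟩ := toSimplex_surj x
  rcases toSimplex_cases (G := G) t S with ⟨a, -, h⟩ | ⟨a, b, hab, -, h⟩ | ⟨i, -, h⟩ | ⟨-, h⟩
  · exact Or.inl ⟨t, a, h⟩
  · exact Or.inr (Or.inl ⟨t, a, b, hab, h⟩)
  · exact Or.inr (Or.inr (Or.inl ⟨t, i, h⟩))
  · exact Or.inr (Or.inr (Or.inr ⟨t, h⟩))

lemma eq_vert_of_dim {x : G.Simplex} (h : x.dim = 0) : ∃ t a, x = G.vert t a := by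
  rcases simplex_cases x with h' | ⟨t, a, b, hab, rfl⟩ | ⟨t, i, rfl⟩ | ⟨t, rfl⟩
  · exact h'
  · simp [dim_mkEdge t hab] at h
  · simp at h
  · simp at h

lemma eq_mkEdge_of_dim {x : G.Simplex} (h : x.dim = 1) :
    ∃ t a b, a ≠ b ∧ x = G.mkEdge t a b := by
  rcases simplex_cases x with ⟨t, a, rfl⟩ | h' | ⟨t, i, rfl⟩ | ⟨t, rfl⟩
  · simp at h
  · exact h'
  · simp at h
  · simp at h

lemma eq_mkTriangle_of_dim {x : G.Simplex} (h : x.dim = 2) : ∃ t i, x = G.mkTriangle t i := by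
  rcases simplex_cases x with ⟨t, a, rfl⟩ | ⟨t, a, b, hab, rfl⟩ | h' | ⟨t, rfl⟩
  · simp at h
  · simp [dim_mkEdge t hab] at h
  · exact h'
  · simp at h

lemma eq_tet_of_dim {x : G.Simplex} (h : x.dim = 3) : ∃ t, x = G.tet t := by
  rcases simplex_cases x with ⟨t, a, rfl⟩ | ⟨t, a, b, hab, rfl⟩ | ⟨t, i, rfl⟩ | h'
  · simp at h
  · simp [dim_mkEdge t hab] at h
  · simp at h
  · exact h'

/-! ### Facets and steps -/

lemma IsFacetOf.dim_eq {η η' : G.Simplex} (h : G.IsFacetOf η η') : η'.dim = η.dim + 1 := by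
  obtain ⟨t, S, S', -, hc, rfl, rfl⟩ := h
  have := dim_toSimplex (G := G) (t, S)
  have := dim_toSimplex (G := G) (t, S')
  simp only at *
  omega

lemma isFacetOf_vert (t : τ) {a b : Fin 4} (h : a ≠ b) :
    G.IsFacetOf (G.vert t a) (G.mkEdge t a b) :=
  ⟨t, ⟨{a, b}, by simp⟩, ⟨{a}, by simp⟩, by simp, by simp [card_pair h], rfl, rfl⟩

lemma isFacetOf_mkEdge (t : τ) {i a b : Fin 4} (h : a ≠ b) (ha : a ≠ i) (hb : b ≠ i) :
    G.IsFacetOf (G.mkEdge t a b) (G.mkTriangle t i) :=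
  ⟨t, ⟨{i}ᶜ, compl_pt_nonempty i⟩, ⟨{a, b}, by simp⟩, by
    intro z hz
    simp only [mem_insert, mem_singleton] at hz
    rcases hz with rfl | rfl <;> simpa, by
    rw [card_pair h, card_compl_pt], rfl, rfl⟩

lemma isFacetOf_mkTriangle (t : τ) (i : Fin 4) : G.IsFacetOf (G.mkTriangle t i) (G.tet t) :=
  ⟨t, ⟨univ, by simp⟩, ⟨{i}ᶜ, compl_pt_nonempty i⟩, by simp, by rw [card_compl_pt]; rfl, rfl, rfl⟩

/-- The facet relation in coordinates, together with the other occurrences of the facet. -/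
lemma facet_cases {t : τ} {S S' : {S : Finset (Fin 4) // S.Nonempty}} (hS : S'.1 ⊆ S.1)
    (hc : S.1.card = S'.1.card + 1) :
    (∃ i, G.toSimplex (t, S) = G.tet t ∧ G.toSimplex (t, S') = G.mkTriangle t i ∧
      ∀ S'' : {S : Finset (Fin 4) // S.Nonempty}, S''.1 ⊆ S.1 → S'' ≠ S' →
        G.toSimplex (t, S'') = G.toSimplex (t, S') →
        ∃ j ≠ i, G.toSimplex (t, S') = G.mkTriangle t j) ∨
    (∃ i a b, a ≠ b ∧ a ≠ i ∧ b ≠ i ∧ G.toSimplex (t, S) = G.mkTriangle t i ∧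
      G.toSimplex (t, S') = G.mkEdge t a b ∧
      ∀ S'' : {S : Finset (Fin 4) // S.Nonempty}, S''.1 ⊆ S.1 → S'' ≠ S' →
        G.toSimplex (t, S'') = G.toSimplex (t, S') →
        ∃ c d, c ≠ d ∧ c ≠ i ∧ d ≠ i ∧ ({c, d} : Finset (Fin 4)) ≠ {a, b} ∧
          G.toSimplex (t, S') = G.mkEdge t c d) ∨
    (∃ a b, a ≠ b ∧ G.toSimplex (t, S) = G.mkEdge t a b ∧
      G.toSimplex (t, S') = G.vert t a ∧
      ∀ S'' : {S : Finset (Fin 4) // S.Nonempty}, S''.1 ⊆ S.1 → S'' ≠ S' →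
        G.toSimplex (t, S'') = G.toSimplex (t, S') → G.toSimplex (t, S') = G.vert t b) := by
  have key : ∀ S'' : {S : Finset (Fin 4) // S.Nonempty},
      G.toSimplex (t, S'') = G.toSimplex (t, S') → S''.1.card = S'.1.card := fun S'' h =>
    card_eq_of_toSimplex_eq h
  rcases toSimplex_cases (G := G) t S with ⟨a, e, h⟩ | ⟨a, b, hab, e, h⟩ | ⟨i, e, h⟩ | ⟨e, h⟩
  · have := card_pos.2 S'.2
    rw [e, card_singleton] at hc; omega
  · right; right
    rw [e, card_pair hab] at hc
    obtain ⟨x, hx⟩ := card_eq_one.1 (show S'.1.card = 1 by omega)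
    have hxm : x = a ∨ x = b := by rw [hx, e] at hS; simpa using hS
    have main : ∀ a b, a ≠ b → S.1 = {a, b} → S'.1 = {a} →
        ∀ S'' : {S : Finset (Fin 4) // S.Nonempty}, S''.1 ⊆ S.1 → S'' ≠ S' →
        G.toSimplex (t, S'') = G.toSimplex (t, S') → G.toSimplex (t, S') = G.vert t b := by
      intro a b hab e hx S'' h1 h2 h3
      have hc' := key S'' h3
      rw [hx, card_singleton] at hc'
      obtain ⟨y, hy⟩ := card_eq_one.1 hc'
      have hym : y = a ∨ y = b := by rw [hy, e] at h1; simpa using h1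
      rcases hym with rfl | rfl
      · exact absurd (Subtype.ext (hy.trans hx.symm)) h2
      · rw [← h3]; unfold vert; congr 2; exact Subtype.ext hy
    rcases hxm with rfl | rfl
    · refine ⟨x, b, hab, h, ?_, main x b hab e hx⟩
      unfold vert; congr 2; exact Subtype.ext hx
    · refine ⟨x, a, hab.symm, h.trans (mkEdge_comm _ _ _), ?_,
        main x a hab.symm (e.trans (pair_comm _ _)) hx⟩
      unfold vert; congr 2; exact Subtype.ext hx
  · right; left
    rw [e, card_compl_pt] at hc
    obtain ⟨a, b, hab, hx⟩ := card_eq_two.1 (show S'.1.card = 2 by omega)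
    have hm : ∀ c ∈ S'.1, c ≠ i := fun c hcS => by
      have := hS hcS; rw [e] at this; simpa using this
    refine ⟨i, a, b, hab, hm a (by simp [hx]), hm b (by simp [hx]), h, ?_, ?_⟩
    · unfold mkEdge; congr 2; exact Subtype.ext hx
    · intro S'' h1 h2 h3
      obtain ⟨c, d, hcd, hy⟩ := card_eq_two.1 ((key S'' h3).trans (by omega : S'.1.card = 2))
      have hm' : ∀ c ∈ S''.1, c ≠ i := fun c hcS => by
        have := h1 hcS; rw [e] at this; simpa using this
      refine ⟨c, d, hcd, hm' c (by simp [hy]), hm' d (by simp [hy]), ?_, ?_⟩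
      · intro h'
        exact h2 (Subtype.ext (hy.trans (h'.trans hx.symm)))
      · rw [← h3]; unfold mkEdge; congr 2; exact Subtype.ext hy
  · left
    rw [e] at hc
    simp only [card_univ, Fintype.card_fin] at hc
    obtain ⟨i, hi⟩ := eq_compl_pt (show S'.1.card = 3 by omega)
    refine ⟨i, h, ?_, ?_⟩
    · unfold mkTriangle; congr 2; exact Subtype.ext hi
    · intro S'' h1 h2 h3
      obtain ⟨j, hj⟩ := eq_compl_pt ((key S'' h3).trans (by omega : S'.1.card = 3))
      refine ⟨j, ?_, ?_⟩
      · rintro rfl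
        exact h2 (Subtype.ext (hj.trans hi.symm))
      · rw [← h3]; unfold mkTriangle; congr 2; exact Subtype.ext hj

lemma IsFacetOf.cases {η η' : G.Simplex} (h : G.IsFacetOf η η') :
    (∃ t i, η' = G.tet t ∧ η = G.mkTriangle t i) ∨
    (∃ t i a b, a ≠ b ∧ a ≠ i ∧ b ≠ i ∧ η' = G.mkTriangle t i ∧ η = G.mkEdge t a b) ∨
    (∃ t a b, a ≠ b ∧ η' = G.mkEdge t a b ∧ η = G.vert t a) := by
  obtain ⟨t, S, S', hS, hc, rfl, rfl⟩ := h
  rcases facet_cases (G := G) (t := t) hS hc with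
    ⟨i, h1, h2, -⟩ | ⟨i, a, b, hab, ha, hb, h1, h2, -⟩ | ⟨a, b, hab, h1, h2, -⟩
  · exact Or.inl ⟨t, i, h1, h2⟩
  · exact Or.inr (Or.inl ⟨t, i, a, b, hab, ha, hb, h1, h2⟩)
  · exact Or.inr (Or.inr ⟨t, a, b, hab, h1, h2⟩)

namespace DiscreteVectorField

variable (V : G.DiscreteVectorField)

lemma StepDown.cases {V : G.DiscreteVectorField} {η' η : G.Simplex} (h : V.StepDown η' η) :
    (∃ t i, η' = G.tet t ∧ η = G.mkTriangle t i ∧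
      ((η, η') ∈ V.pairs → ∃ j ≠ i, η = G.mkTriangle t j)) ∨
    (∃ t i a b, a ≠ b ∧ a ≠ i ∧ b ≠ i ∧ η' = G.mkTriangle t i ∧ η = G.mkEdge t a b ∧
      ((η, η') ∈ V.pairs → ∃ c d, c ≠ d ∧ c ≠ i ∧ d ≠ i ∧
        ({c, d} : Finset (Fin 4)) ≠ {a, b} ∧ η = G.mkEdge t c d)) ∨
    (∃ t a b, a ≠ b ∧ η' = G.mkEdge t a b ∧ η = G.vert t a ∧
      ((η, η') ∈ V.pairs → η = G.vert t b)) := by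
  obtain ⟨t, S, S', hS, hc, rfl, rfl, hp⟩ := h
  rcases facet_cases (G := G) (t := t) hS hc with
    ⟨i, h1, h2, h⟩ | ⟨i, a, b, hab, ha, hb, h1, h2, h⟩ | ⟨a, b, hab, h1, h2, h⟩
  · refine Or.inl ⟨t, i, h1, h2, fun hm => ?_⟩
    obtain ⟨S'', k1, k2, k3⟩ := hp hm
    exact h S'' k1 k2 k3
  · refine Or.inr (Or.inl ⟨t, i, a, b, hab, ha, hb, h1, h2, fun hm => ?_⟩)
    obtain ⟨S'', k1, k2, k3⟩ := hp hm
    exact h S'' k1 k2 k3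
  · refine Or.inr (Or.inr ⟨t, a, b, hab, h1, h2, fun hm => ?_⟩)
    obtain ⟨S'', k1, k2, k3⟩ := hp hm
    exact h S'' k1 k2 k3

/-- Here and in the next two lemmas, a second occurrence of the facet is required only if the facet
is oriented towards the simplex that the walk leaves. -/
lemma step_tet (t : τ) (i : Fin 4)
    (h : (G.mkTriangle t i, G.tet t) ∈ V.pairs → ∃ j ≠ i, G.mkTriangle t i = G.mkTriangle t j) :
    V.Step (G.tet t) (G.mkTriangle t i) := by
  refine Or.inr ⟨t, ⟨univ, by simp⟩, ⟨{i}ᶜ, compl_pt_nonempty i⟩, by simp,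
    by rw [card_compl_pt]; rfl, rfl, rfl, fun hm => ?_⟩
  obtain ⟨j, hj, e⟩ := h hm
  exact ⟨⟨{j}ᶜ, compl_pt_nonempty j⟩, by simp, by simpa using hj, e.symm⟩

lemma step_triangle (t : τ) {i a b : Fin 4} (hab : a ≠ b) (ha : a ≠ i) (hb : b ≠ i)
    (h : (G.mkEdge t a b, G.mkTriangle t i) ∈ V.pairs → ∃ c d, c ≠ i ∧ d ≠ i ∧
      ({c, d} : Finset (Fin 4)) ≠ {a, b} ∧ G.mkEdge t a b = G.mkEdge t c d) :
    V.Step (G.mkTriangle t i) (G.mkEdge t a b) := by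
  have sub : ∀ a b, a ≠ i → b ≠ i → ({a, b} : Finset (Fin 4)) ⊆ {i}ᶜ := by
    intro a b ha hb z hz
    simp only [mem_insert, mem_singleton] at hz
    rcases hz with rfl | rfl <;> simpa
  refine Or.inr ⟨t, ⟨{i}ᶜ, compl_pt_nonempty i⟩, ⟨{a, b}, by simp⟩, sub a b ha hb,
    by rw [card_pair hab, card_compl_pt], rfl, rfl, fun hm => ?_⟩
  obtain ⟨c, d, hc, hd, hne, e⟩ := h hm
  exact ⟨⟨{c, d}, by simp⟩, sub c d hc hd, by simpa using hne, e.symm⟩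

lemma step_edge (t : τ) {a b : Fin 4} (hab : a ≠ b)
    (h : (G.vert t a, G.mkEdge t a b) ∈ V.pairs → G.vert t a = G.vert t b) :
    V.Step (G.mkEdge t a b) (G.vert t a) := by
  refine Or.inr ⟨t, ⟨{a, b}, by simp⟩, ⟨{a}, by simp⟩, by simp,
    by simp [card_pair hab], rfl, rfl, fun hm => ?_⟩
  exact ⟨⟨{b}, by simp⟩, by simp, by simpa using hab.symm, (h hm).symm⟩

end DiscreteVectorField

end Basic

/-! ### Links of edges in partial gluings -/

section EdgeLinks

variable {G : Gluing τ}

/-- The flags `(t, i, a, b)`, consisting of a directed edge of the class of `(t₀, a₀, b₀)` and a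
triangle `(t, i)` containing it. -/
def edgeFlags (G : Gluing τ) (x : τ × Fin 4 × Fin 4) : Set ((τ × Fin 4 × Fin 4) × Fin 4) :=
  {y | G.SameDirEdge x y.1 ∧ y.2 ≠ y.1.2.1 ∧ y.2 ≠ y.1.2.2}

/-- An edge of a tetrahedron lies in exactly two of its triangles. -/
lemma ncard_edgeFlags [Finite τ] {x : τ × Fin 4 × Fin 4} (hx : x.2.1 ≠ x.2.2) :
    (G.edgeFlags x).ncard = 2 * {y | G.SameDirEdge x y}.ncard := by
  classical
  have hs := Set.toFinite (G.edgeFlags x)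
  have hC := Set.toFinite {y | G.SameDirEdge x y}
  rw [Set.ncard_eq_toFinset_card _ hs, Set.ncard_eq_toFinset_card _ hC]
  rw [Finset.card_eq_sum_card_fiberwise (f := Prod.fst) (t := hC.toFinset), mul_comm,
    ← smul_eq_mul]
  · refine Finset.sum_const_nat ?_
    intro y hy
    have hy' : G.SameDirEdge x y := by simpa using hy
    have hne := hy'.ne_iff.1 hx
    have : hs.toFinset.filter (fun z => z.1 = y) =
        ((univ : Finset (Fin 4)).filter (fun i => i ≠ y.2.1 ∧ i ≠ y.2.2)).map
          ⟨fun i => (y, i), fun i j h => (Prod.mk.inj h).2⟩ := by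
      ext ⟨z, i⟩
      rw [mem_filter, Set.Finite.mem_toFinset, mem_map]
      constructor
      · rintro ⟨⟨-, h1, h2⟩, rfl⟩
        exact ⟨i, mem_filter.2 ⟨mem_univ _, h1, h2⟩, rfl⟩
      · rintro ⟨j, hj, e⟩
        cases e
        exact ⟨⟨hy', (mem_filter.1 hj).2⟩, rfl⟩
    rw [this, card_map]
    revert hne
    generalize y.2.1 = c
    generalize y.2.2 = d
    revert c d
    decide
  · intro y hy
    have : y ∈ G.edgeFlags x := by simpa using hy
    simpa using this.1

/-- The flag on the other side of the triangle of a given flag. -/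
def crossFlag (G : Gluing τ) (y : (τ × Fin 4 × Fin 4) × Fin 4) : (τ × Fin 4 × Fin 4) × Fin 4 :=
  match G.glue y.1.1 y.2 with
  | none => y
  | some (u, p) => ((u, p y.1.2.1, p y.1.2.2), p y.2)

lemma crossFlag_of_some {y : (τ × Fin 4 × Fin 4) × Fin 4} {u : τ} {p : Equiv.Perm (Fin 4)}
    (h : G.glue y.1.1 y.2 = some (u, p)) :
    G.crossFlag y = ((u, p y.1.2.1, p y.1.2.2), p y.2) := by
  unfold crossFlag; rw [h]

/-- If all triangles around an edge are glued, except for the two sides of a single triangle, then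
the two sides share that edge. -/
lemma sameDirEdge_of_boundary [Finite τ] {t₁ t₂ : τ} {f a b : Fin 4} {p : Equiv.Perm (Fin 4)}
    (hab : a ≠ b) (ha : a ≠ f) (hb : b ≠ f) (h₁ : G.glue t₁ f = none)
    (H : ∀ y ∈ G.edgeFlags (t₁, a, b), G.glue y.1.1 y.2 = none →
      y = ((t₁, a, b), f) ∨ y = ((t₂, p a, p b), p f)) :
    G.SameDirEdge (t₁, a, b) (t₂, p a, p b) := by
  classical
  by_contra hn
  have hs := Set.toFinite (G.edgeFlags (t₁, a, b))
  have hx₀ : ((t₁, a, b), f) ∈ G.edgeFlags (t₁, a, b) := ⟨EqvGen.refl _, ha.symm, hb.symm⟩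
  have hglued : ∀ y ∈ G.edgeFlags (t₁, a, b), y ≠ ((t₁, a, b), f) →
      ∃ u q, G.glue y.1.1 y.2 = some (u, q) := by
    intro y hy hne
    rcases h : G.glue y.1.1 y.2 with _ | ⟨u, q⟩
    · rcases H y hy h with h' | h'
      · exact absurd h' hne
      · subst h'; exact absurd hy.1 hn
    · exact ⟨u, q, rfl⟩
  -- If the second side lay outside the class, `((t₁, a, b), f)` would be the only boundary flag.
  -- Crossing triangles is then an involution without fixed points on the remaining flags, so their
  -- number is even. Working in `ZMod 2` lets the flags cancel in pairs.
  have hcard : ((hs.toFinset.erase ((t₁, a, b), f)).card : ZMod 2) = 0 := by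
    rw [Finset.card_eq_sum_ones, Nat.cast_sum]
    refine Finset.sum_involution (fun y _ => G.crossFlag y) ?_ ?_ ?_ ?_
    · intro y _
      exact (by decide : ((1 : ℕ) : ZMod 2) + ((1 : ℕ) : ZMod 2) = 0)
    · intro y hy _
      rw [mem_erase, Set.Finite.mem_toFinset] at hy
      obtain ⟨u, q, hg⟩ := hglued y hy.2 hy.1
      rw [crossFlag_of_some hg]
      intro h
      apply G.glue_ne _ _ _ _ hg
      exact Prod.ext (congrArg (fun z : (τ × Fin 4 × Fin 4) × Fin 4 => z.1.1) h)
        (congrArg (fun z : (τ × Fin 4 × Fin 4) × Fin 4 => z.2) h)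
    · intro y hy
      rw [mem_erase, Set.Finite.mem_toFinset] at hy ⊢
      obtain ⟨u, q, hg⟩ := hglued y hy.2 hy.1
      rw [crossFlag_of_some hg]
      refine ⟨?_, ?_, ?_, ?_⟩
      · intro h
        have h2 := G.glue_symm _ _ _ _ hg
        rw [show u = t₁ from congrArg (fun z => z.1.1) h,
          show q y.2 = f from congrArg Prod.snd h, h₁] at h2
        cases h2
      · exact EqvGen.trans _ _ _ hy.2.1
          (EqvGen.rel _ _ ⟨y.2, q, hg, hy.2.2.1, hy.2.2.2, rfl, rfl⟩)
      · simpa using hy.2.2.1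
      · simpa using hy.2.2.2
    · intro y hy
      rw [mem_erase, Set.Finite.mem_toFinset] at hy
      obtain ⟨u, q, hg⟩ := hglued y hy.2 hy.1
      have h2 := G.glue_symm _ _ _ _ hg
      rw [crossFlag_of_some hg, crossFlag_of_some (u := y.1.1) (p := q⁻¹) h2]
      simp
  have hmem : ((t₁, a, b), f) ∈ hs.toFinset := by simpa using hx₀
  have h1 := card_erase_add_one hmem
  have h2 := ncard_edgeFlags (G := G) (x := (t₁, a, b)) hab
  rw [Set.ncard_eq_toFinset_card _ hs] at h2
  -- With the erased flag put back the number of flags is odd, whereas it is twice the size of the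
  -- class.
  have h3 : ((2 * {y | G.SameDirEdge (t₁, a, b) y}.ncard : ℕ) : ZMod 2) = 1 := by
    rw [← h2, ← h1]; push_cast; rw [hcard]; simp
  rw [Nat.cast_mul] at h3
  have h4 : ((2 : ℕ) : ZMod 2) = 0 := by decide
  rw [h4, zero_mul] at h3
  exact absurd h3 (by decide)

lemma DirEdgeIdent.symm {x y : τ × Fin 4 × Fin 4} (h : G.DirEdgeIdent x y) :
    G.DirEdgeIdent y x := by
  obtain ⟨i, p, hg, ha, hb, h1, h2⟩ := h
  refine ⟨p i, p⁻¹, G.glue_symm _ _ _ _ hg, ?_, ?_, ?_, ?_⟩ <;> simp [h1, h2, ha, hb]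

/-- The class of a directed edge, as a graph. -/
def edgeLinkGraph (G : Gluing τ) (x : τ × Fin 4 × Fin 4) :
    SimpleGraph {y // G.SameDirEdge x y} where
  Adj y z := y ≠ z ∧ G.DirEdgeIdent y z
  symm := ⟨fun _ _ h => ⟨h.1.symm, h.2.symm⟩⟩
  loopless := ⟨fun _ h => h.1 rfl⟩

lemma edgeLinkGraph_connected (x : τ × Fin 4 × Fin 4) : (G.edgeLinkGraph x).Connected := by
  have key : ∀ y z (hyz : G.SameDirEdge y z) (hy : G.SameDirEdge x y) (hz : G.SameDirEdge x z),
      (G.edgeLinkGraph x).Reachable ⟨y, hy⟩ ⟨z, hz⟩ := by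
    intro y z hyz
    induction hyz with
    | rel y z h =>
      intro hy hz
      by_cases hne : y = z
      · subst hne; exact SimpleGraph.Reachable.refl _
      · exact SimpleGraph.Adj.reachable ⟨fun h' => hne (congrArg Subtype.val h'), h⟩
    | refl y => intro hy hz; exact SimpleGraph.Reachable.refl _
    | symm y z _ ih => intro hy hz; exact (ih hz hy).symm
    | trans y z w hyz _ ih1 ih2 =>
      intro hy hw
      exact (ih1 hy (EqvGen.trans _ _ _ hy hyz)).trans (ih2 _ hw)
  have : Nonempty {y // G.SameDirEdge x y} := ⟨⟨x, EqvGen.refl _⟩⟩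
  exact ⟨fun y z => key _ _ (EqvGen.trans _ _ _ (EqvGen.symm _ _ y.2) z.2) _ _⟩

/-- The link of an edge has at most two boundary points. -/
lemma boundary_edgeFlags [Finite τ] {x : τ × Fin 4 × Fin 4} (hx : x.2.1 ≠ x.2.2)
    {y₁ y₂ y : (τ × Fin 4 × Fin 4) × Fin 4} (hne : y₁ ≠ y₂)
    (hy₁ : y₁ ∈ G.edgeFlags x) (hy₂ : y₂ ∈ G.edgeFlags x) (hy : y ∈ G.edgeFlags x)
    (h₁ : G.glue y₁.1.1 y₁.2 = none) (h₂ : G.glue y₂.1.1 y₂.2 = none)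
    (h : G.glue y.1.1 y.2 = none) : y = y₁ ∨ y = y₂ := by
  classical
  by_contra hcon
  push Not at hcon
  have := Fintype.ofFinite τ
  have := Fintype.ofFinite {y // G.SameDirEdge x y}
  -- With m directed edges in the class, connectedness gives at least m − 1 adjacencies, hence 2m −
  -- 2 darts and as many glued flags. Three boundary flags would leave only 2m − 3 of the 2m flags.
  have hc := (G.edgeLinkGraph_connected x).card_vert_le_card_edgeSet_add_one
  have hd := (G.edgeLinkGraph x).dart_card_eq_twice_card_edges
  set S : Set ((τ × Fin 4 × Fin 4) × Fin 4) :=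
    {z | z ∈ G.edgeFlags x ∧ G.glue z.1.1 z.2 ≠ none} with hS
  -- A dart crosses some glued triangle. The resulting flag determines the gluing map and so the end
  -- of the dart, which makes the choice injective.
  have hdart : ∀ d : (G.edgeLinkGraph x).Dart, ∃ i p, G.glue d.fst.1.1 i = some (d.snd.1.1, p) ∧
      i ≠ d.fst.1.2.1 ∧ i ≠ d.fst.1.2.2 ∧ d.snd.1.2.1 = p d.fst.1.2.1 ∧
      d.snd.1.2.2 = p d.fst.1.2.2 := fun d => d.adj.2
  choose i p hg hi1 hi2 hp1 hp2 using hdart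
  have hle : Fintype.card (G.edgeLinkGraph x).Dart ≤ S.ncard := by
    rw [← Nat.card_eq_fintype_card, ← Nat.card_coe_set_eq]
    refine Nat.card_le_card_of_injective
      (fun d => (⟨(d.fst.1, i d), ⟨d.fst.2, hi1 d, hi2 d⟩, by rw [hg d]; simp⟩ : S)) ?_
    intro d e hde
    have e1 : d.fst.1 = e.fst.1 := congrArg (fun z : S => z.1.1) hde
    have e2 : i d = i e := congrArg (fun z : S => z.1.2) hde
    have e3 := hg d
    rw [e1, e2, hg e] at e3
    obtain ⟨e4, e5⟩ := Prod.mk.inj (Option.some.inj e3)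
    have e6 : d.snd.1 = e.snd.1 := by
      refine Prod.ext e4.symm (Prod.ext ?_ ?_)
      · rw [hp1, hp1, e1, e5]
      · rw [hp2, hp2, e1, e5]
    exact SimpleGraph.Dart.ext _ _ (Prod.ext (Subtype.ext e1) (Subtype.ext e6))
  have hlt : S.ncard + 3 ≤ (G.edgeFlags x).ncard := by
    have h3 : ({y, y₁, y₂} : Set ((τ × Fin 4 × Fin 4) × Fin 4)).ncard = 3 := by
      rw [Set.ncard_eq_toFinset_card']
      simp [card_insert_of_notMem, hcon.1, hcon.2, hne]
    rw [← h3, ← Set.ncard_union_eq]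
    · refine Set.ncard_le_ncard ?_ (Set.toFinite _)
      rintro z (hz | rfl | rfl | rfl)
      · exact hz.1
      all_goals assumption
    · rw [Set.disjoint_left]
      rintro z hz (rfl | rfl | rfl)
      · exact hz.2 h
      · exact hz.2 h₁
      · exact hz.2 h₂
  rw [ncard_edgeFlags hx] at hlt
  have hcc : {y | G.SameDirEdge x y}.ncard = Nat.card {y // G.SameDirEdge x y} :=
    (Nat.card_coe_set_eq _).symm
  rw [hcc] at hlt
  rw [Nat.card_eq_fintype_card (α := (G.edgeLinkGraph x).edgeSet),
    ← SimpleGraph.edgeFinset_card] at hc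
  rw [hd] at hle
  omega

end EdgeLinks

instance [Finite τ] (G : Gluing τ) : Finite G.Simplex :=
  Finite.of_surjective G.toSimplex toSimplex_surj

lemma IsClosedTriangulation.exists_glue {T : Gluing τ} (hT : T.IsClosedTriangulation) (t : τ)
    (i : Fin 4) : ∃ u p, T.glue t i = some (u, p) := by
  rcases h : T.glue t i with _ | ⟨u, p⟩
  · exact absurd h (hT.closed t i)
  · exact ⟨u, p, rfl⟩

/-! ### Consequences of acyclicity and of having two critical simplices -/

namespace DiscreteVectorField

variable {G : Gluing τ} {V : G.DiscreteVectorField}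

/-- Minimal elements for this order are sources of the flow; the swapped version provides sinks. -/
lemma IsAcyclic.wellFounded [Finite τ] (h : V.IsAcyclic) : WellFounded (TransGen V.Step) := by
  have : Std.Irrefl (TransGen V.Step) := ⟨h⟩
  exact Finite.wellFounded_of_trans_of_irrefl _

lemma IsAcyclic.wellFounded_swap [Finite τ] (h : V.IsAcyclic) :
    WellFounded (Function.swap (TransGen V.Step)) := by
  have : Std.Irrefl (Function.swap (TransGen V.Step)) := ⟨h⟩
  exact Finite.wellFounded_of_trans_of_irrefl _

lemma not_mem_critical {x : G.Simplex} (h : x ∉ V.critical) :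
    ∃ a b, (a, b) ∈ V.pairs ∧ (x = a ∨ x = b) := by
  by_contra hn
  apply h
  intro a b hab
  exact ⟨fun e => hn ⟨a, b, hab, Or.inl e⟩, fun e => hn ⟨a, b, hab, Or.inr e⟩⟩

lemma mem_critical_iff {x : G.Simplex} :
    x ∈ V.critical ↔ ∀ y, (x, y) ∉ V.pairs ∧ (y, x) ∉ V.pairs := by
  constructor
  · intro h y
    exact ⟨fun h' => (h _ _ h').1 rfl, fun h' => (h _ _ h').2 rfl⟩
  · intro h a b hab
    exact ⟨fun e => (h b).1 (e ▸ hab), fun e => (h a).2 (e ▸ hab)⟩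

lemma dim_eq_of_mem {a b : G.Simplex} (h : (a, b) ∈ V.pairs) : b.dim = a.dim + 1 :=
  (V.isFacetOf _ _ h).dim_eq

lemma dim_le_three (x : G.Simplex) : x.dim ≤ 3 := by
  rcases simplex_cases x with ⟨t, a, rfl⟩ | ⟨t, a, b, hab, rfl⟩ | ⟨t, i, rfl⟩ | ⟨t, rfl⟩ <;>
    simp [dim_mkEdge, *]

lemma pair_tet {t : τ} {f : G.Simplex} (h : (f, G.tet t) ∈ V.pairs) :
    ∃ i, f = G.mkTriangle t i := by
  rcases (V.isFacetOf _ _ h).cases with ⟨u, i, e, rfl⟩ | ⟨u, i, a, b, hab, ha, hb, e, rfl⟩ |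
    ⟨u, a, b, hab, e, rfl⟩
  · obtain rfl := tet_injective e
    exact ⟨i, rfl⟩
  · have := congrArg Simplex.dim e; simp at this
  · have := congrArg Simplex.dim e; simp [dim_mkEdge u hab] at this

lemma tet_pair_of_not_critical {t : τ} (h : G.tet t ∉ V.critical) :
    ∃ i, (G.mkTriangle t i, G.tet t) ∈ V.pairs := by
  obtain ⟨a, b, hab, rfl | rfl⟩ := not_mem_critical h
  · have := dim_eq_of_mem hab
    have := dim_le_three b
    simp at *; omega
  · obtain ⟨i, rfl⟩ := pair_tet hab
    exact ⟨i, hab⟩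

/-- From the other side of a triangle one can step through it. -/
lemma step_of_tet_pair {t u : τ} {i : Fin 4} {p : Equiv.Perm (Fin 4)}
    (h : (G.mkTriangle t i, G.tet t) ∈ V.pairs) (hg : G.glue t i = some (u, p)) :
    TransGen V.Step (G.tet u) (G.tet t) := by
  refine TransGen.head (b := G.mkTriangle t i) ?_ (TransGen.single (Or.inl h))
  rw [mkTriangle_glue hg]
  refine step_tet V u (p i) fun hm => ?_
  have e : G.tet u = G.tet t := (V.disjoint _ _ _ _ hm h (Or.inl (mkTriangle_glue hg).symm)).2
  obtain rfl := tet_injective e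
  refine ⟨i, ?_, (mkTriangle_glue hg).symm⟩
  rintro h'
  exact G.glue_ne _ _ _ _ hg (by rw [← h'])

lemma ne_of_tet_pair (hV : V.IsAcyclic) {t u : τ} {i : Fin 4} {p : Equiv.Perm (Fin 4)}
    (h : (G.mkTriangle t i, G.tet t) ∈ V.pairs) (hg : G.glue t i = some (u, p)) : t ≠ u := by
  rintro rfl
  exact hV _ (step_of_tet_pair h hg)

/-- A paired tetrahedron is reached from the one across its triangle, so a source among the
tetrahedra is critical. -/
lemma exists_critical_tet [Finite τ] (hG : G.IsClosedTriangulation) (hV : V.IsAcyclic) :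
    ∃ t, G.tet t ∈ V.critical := by
  by_contra hn
  push Not at hn
  have := hG.connected.nonempty
  obtain ⟨_, ⟨t, rfl⟩, ht⟩ := hV.wellFounded.has_min (Set.range G.tet) (Set.range_nonempty _)
  obtain ⟨i, hi⟩ := tet_pair_of_not_critical (hn t)
  obtain ⟨u, p, hg⟩ := hG.exists_glue t i
  exact ht _ ⟨u, rfl⟩ (step_of_tet_pair hi hg)

lemma vert_pair_of_not_critical {x : G.Simplex} (hx : x.dim = 0) (h : x ∉ V.critical) :
    ∃ t a b, a ≠ b ∧ x = G.vert t a ∧ (G.vert t a, G.mkEdge t a b) ∈ V.pairs := by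
  obtain ⟨c, d, hcd, rfl | rfl⟩ := not_mem_critical h
  · rcases (V.isFacetOf _ _ hcd).cases with ⟨u, i, rfl, rfl⟩ |
      ⟨u, i, a, b, hab, ha, hb, rfl, rfl⟩ | ⟨u, a, b, hab, rfl, rfl⟩
    · simp at hx
    · simp [dim_mkEdge u hab] at hx
    · exact ⟨u, a, b, hab, rfl, hcd⟩
  · have := dim_eq_of_mem hcd
    omega

/-- A paired vertex flows to the other end of its edge, so a sink among the vertices is critical. -/
lemma exists_critical_vert [Finite τ] (hG : G.IsClosedTriangulation) (hV : V.IsAcyclic) :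
    ∃ x ∈ V.critical, x.dim = 0 := by
  by_contra hn
  push Not at hn
  obtain ⟨t₀⟩ := hG.connected.nonempty
  obtain ⟨x, hx, hmin⟩ := hV.wellFounded_swap.has_min {x : G.Simplex | x.dim = 0}
    ⟨G.vert t₀ 0, rfl⟩
  obtain ⟨t, a, b, hab, rfl, hp⟩ := vert_pair_of_not_critical hx (fun h => hn _ h hx)
  refine hmin (G.vert t b) rfl ?_
  refine TransGen.head (b := G.mkEdge t a b) (Or.inl hp) (TransGen.single ?_)
  rw [mkEdge_comm]
  refine step_edge V t hab.symm fun hm => ?_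
  rw [mkEdge_comm] at hm
  exact (V.disjoint _ _ _ _ hm hp (Or.inr (Or.inr (Or.inr rfl)))).1

/-- The consequences of having exactly two critical simplices. -/
lemma critical_eq [Finite τ] (hG : G.IsClosedTriangulation) (hV : V.IsAcyclic)
    (h2 : V.critical.ncard = 2) :
    ∃ t₀ v₀, v₀.dim = 0 ∧ V.critical = {G.tet t₀, v₀} := by
  obtain ⟨t₀, ht₀⟩ := exists_critical_tet hG hV
  obtain ⟨v₀, hv₀, hd⟩ := exists_critical_vert hG hV
  refine ⟨t₀, v₀, hd, (Set.eq_of_subset_of_ncard_le ?_ ?_ (Set.toFinite _)).symm⟩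
  · rintro x (rfl | rfl) <;> assumption
  · rw [h2, Set.ncard_pair]
    rintro rfl
    simp at hd

lemma exists_tet_pair [Finite τ] (hG : G.IsClosedTriangulation) (hV : V.IsAcyclic)
    (h2 : V.critical.ncard = 2) :
    ∃ t₀, ∀ t ≠ t₀, ∃ i, (G.mkTriangle t i, G.tet t) ∈ V.pairs := by
  obtain ⟨t₀, v₀, hd, hc⟩ := critical_eq hG hV h2
  refine ⟨t₀, fun t ht => tet_pair_of_not_critical ?_⟩
  rw [hc]
  rintro (h | h)
  · exact ht (tet_injective h)
  · rw [← h] at hd; simp at hd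

/-- The two critical simplices have dimensions 0 and 3, so each edge is in exactly one pair, either
as the target of a vertex or as the source of a triangle. -/
lemma edge_or_middle [Finite τ] (hG : G.IsClosedTriangulation) (hV : V.IsAcyclic)
    (h2 : V.critical.ncard = 2) {e : G.Simplex} (he : e.dim = 1) :
    e ∈ V.edgeForest ↔ ∀ x ∈ V.middlePairs, x.1 ≠ e := by
  constructor
  · rintro ⟨-, v, hv⟩ ⟨e', f⟩ hx rfl
    have h1 := (V.disjoint _ _ _ _ hv hx.1 (Or.inr (Or.inr (Or.inl rfl)))).1
    have h2 := dim_eq_of_mem hv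
    rw [h1] at h2
    exact Nat.succ_ne_self _ h2.symm
  · intro h
    obtain ⟨t₀, v₀, hd, hc⟩ := critical_eq hG hV h2
    have : e ∉ V.critical := by
      rw [hc]
      rintro (h | h) <;> rw [h] at he
      · simp at he
      · omega
    obtain ⟨a, b, hab, rfl | rfl⟩ := not_mem_critical this
    · exact absurd rfl (h _ ⟨hab, he⟩)
    · exact ⟨he, a, hab⟩

lemma dual_or_middle [Finite τ] (hG : G.IsClosedTriangulation) (hV : V.IsAcyclic)
    (h2 : V.critical.ncard = 2) {f : G.Simplex} (hf : f.dim = 2) :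
    f ∈ V.dualForest ∨ ∃ x ∈ V.middlePairs, x.2 = f := by
  obtain ⟨t₀, v₀, hd, hc⟩ := critical_eq hG hV h2
  have : f ∉ V.critical := by
    rw [hc]
    rintro (h | h) <;> rw [h] at hf
    · simp at hf
    · omega
  obtain ⟨a, b, hab, rfl | rfl⟩ := not_mem_critical this
  · exact Or.inl ⟨hf, b, hab⟩
  · have := dim_eq_of_mem hab
    exact Or.inr ⟨(a, f), ⟨hab, by simp only; omega⟩, rfl⟩

lemma not_dual_of_middle {x : G.Simplex × G.Simplex} (hx : x ∈ V.middlePairs) :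
    x.2 ∉ V.dualForest := by
  rintro ⟨hd, t, ht⟩
  have h1 := (V.disjoint _ _ _ _ ht hx.1 (Or.inr (Or.inl rfl))).1
  have h2 := dim_eq_of_mem hx.1
  rw [← h1] at h2
  exact Nat.succ_ne_self _ h2.symm

end DiscreteVectorField

/-! ### Restricting a gluing to a set of triangles -/

open Classical in
/-- The partial gluing along the triangles of `F` only. -/
noncomputable def restrict (T : Gluing τ) (F : Set T.Simplex) : Gluing τ where
  glue t i := if T.mkTriangle t i ∈ F then T.glue t i else none
  glue_symm t i u p h := by
    split_ifs at h with hF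
    rw [if_pos (by rwa [← mkTriangle_glue h])]
    exact T.glue_symm _ _ _ _ h
  glue_ne t i u p h := by
    split_ifs at h with hF
    exact T.glue_ne _ _ _ _ h

section Restrict

variable {T : Gluing τ} {F : Set T.Simplex}

lemma restrict_glue_of_mem {t : τ} {i : Fin 4} (h : T.mkTriangle t i ∈ F) :
    (T.restrict F).glue t i = T.glue t i := if_pos h

lemma restrict_glue_of_not_mem {t : τ} {i : Fin 4} (h : T.mkTriangle t i ∉ F) :
    (T.restrict F).glue t i = none := if_neg h

lemma restrict_glue_eq_some {t : τ} {i : Fin 4} {q : τ × Equiv.Perm (Fin 4)} :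
    (T.restrict F).glue t i = some q ↔ T.mkTriangle t i ∈ F ∧ T.glue t i = some q := by
  by_cases h : T.mkTriangle t i ∈ F
  · rw [restrict_glue_of_mem h]; simp [h]
  · rw [restrict_glue_of_not_mem h]; simp [h]

lemma restrict_glue_eq_none (hT : T.IsClosedTriangulation) {t : τ} {i : Fin 4} :
    (T.restrict F).glue t i = none ↔ T.mkTriangle t i ∉ F := by
  by_cases h : T.mkTriangle t i ∈ F
  · rw [restrict_glue_of_mem h]; simp [h, hT.closed]
  · rw [restrict_glue_of_not_mem h]; simp [h]

end Restrict

/-- Directed edges identified in a partial gluing are identified in the full one. -/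
lemma SameDirEdge.mono {G G' : Gluing τ}
    (h : ∀ t i q, G.glue t i = some q → G'.glue t i = some q) {x y : τ × Fin 4 × Fin 4}
    (hxy : G.SameDirEdge x y) : G'.SameDirEdge x y :=
  EqvGen.mono (r := G.DirEdgeIdent) (p := G'.DirEdgeIdent)
    (fun _ _ ⟨i, p, hg, h'⟩ => ⟨i, p, h _ _ _ hg, h'⟩) _ _ hxy

/-! ### The tree of tetrahedra of a gradient and an order on its middle pairs -/

namespace DiscreteVectorField

variable {T : Gluing τ} {V : T.DiscreteVectorField}

lemma mem_dualForest_cases {t u : τ} {i : Fin 4} {p : Equiv.Perm (Fin 4)}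
    (h : T.mkTriangle t i ∈ V.dualForest) (hg : T.glue t i = some (u, p)) :
    (T.mkTriangle t i, T.tet t) ∈ V.pairs ∨ (T.mkTriangle t i, T.tet u) ∈ V.pairs := by
  obtain ⟨-, x, hx⟩ := h
  have hd := dim_eq_of_mem hx
  rw [dim_mkTriangle] at hd
  obtain ⟨w, rfl⟩ := eq_tet_of_dim hd
  obtain ⟨j, hj⟩ := pair_tet hx
  rcases mkTriangle_eq_iff.1 hj with ⟨rfl, -⟩ | ⟨q, hq, -⟩
  · exact Or.inl hx
  · rw [hg] at hq
    obtain ⟨rfl, -⟩ := Prod.mk.inj (Option.some.inj hq)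
    exact Or.inr hx

lemma mem_dualForest_ne (hV : V.IsAcyclic) {t u : τ} {i : Fin 4} {p : Equiv.Perm (Fin 4)}
    (h : T.mkTriangle t i ∈ V.dualForest) (hg : T.glue t i = some (u, p)) : t ≠ u := by
  rcases mem_dualForest_cases h hg with h | h
  · exact ne_of_tet_pair hV h hg
  · rw [mkTriangle_glue hg] at h
    exact (ne_of_tet_pair hV h (T.glue_symm _ _ _ _ hg)).symm

/-- The tetrahedron across the paired triangle of `t` serves as the parent of `t`. It precedes `t`
in the flow, so ancestors end at the critical tetrahedron, which gives connectedness. Each adjacency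
comes from one of the N − 1 parent triangles. A loop or a double edge would give a closed walk or
two pairs sharing a simplex. -/
lemma isTreeOfTetrahedra [Finite τ] (hT : T.IsClosedTriangulation) (hV : V.IsAcyclic)
    (h2 : V.critical.ncard = 2) : (T.restrict V.dualForest).IsTreeOfTetrahedra := by
  obtain ⟨t₀, ht₀⟩ := exists_tet_pair hT hV h2
  have hpar : ∀ t : {t // t ≠ t₀}, ∃ i u p, (T.mkTriangle t.1 i, T.tet t.1) ∈ V.pairs ∧
      T.glue t.1 i = some (u, p) := by
    rintro ⟨t, ht⟩
    obtain ⟨i, hi⟩ := ht₀ t ht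
    obtain ⟨u, p, hg⟩ := hT.exists_glue t i
    exact ⟨i, u, p, hi, hg⟩
  choose i u p hpair hglue using hpar
  have hne := fun t => ne_of_tet_pair hV (hpair t) (hglue t)
  have hadj : ∀ t : {t // t ≠ t₀}, (T.restrict V.dualForest).dualGraph.Adj t.1 (u t) := fun t =>
    ⟨hne t, i t, p t, restrict_glue_eq_some.2 ⟨⟨by simp, _, hpair t⟩, hglue t⟩⟩
  refine ⟨?_, ?_, ?_⟩
  · have hconn : (T.restrict V.dualForest).dualGraph.Connected := by
      have key : ∀ x : T.Simplex, ∀ t, x = T.tet t →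
          (T.restrict V.dualForest).dualGraph.Reachable t t₀ := by
        intro x
        induction x using hV.wellFounded.induction with
        | h x ih =>
          rintro t rfl
          by_cases ht : t = t₀
          · rw [ht]
          · exact (hadj ⟨t, ht⟩).reachable.trans
              (ih _ (step_of_tet_pair (hpair ⟨t, ht⟩) (hglue ⟨t, ht⟩)) _ rfl)
      have : Nonempty τ := ⟨t₀⟩
      exact ⟨fun a b => (key _ a rfl).trans (key _ b rfl).symm⟩
    rw [SimpleGraph.isTree_iff_connected_and_card]
    refine ⟨hconn, le_antisymm ?_ hconn.card_vert_le_card_edgeSet_add_one⟩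
    have h1 : Nat.card (T.restrict V.dualForest).dualGraph.edgeSet ≤ Nat.card {t // t ≠ t₀} := by
      refine Nat.card_le_card_of_surjective
        (fun t => (⟨s(t.1, u t), hadj t⟩ : (T.restrict V.dualForest).dualGraph.edgeSet)) ?_
      rintro ⟨e, he⟩
      induction e using Sym2.ind with
      | _ a b =>
        have main : ∀ a b j q, T.glue a j = some (b, q) →
            (T.mkTriangle a j, T.tet a) ∈ V.pairs → a ≠ t₀ ∧ ∀ h, u ⟨a, h⟩ = b := by
          intro a b j q hg hp
          have ha : a ≠ t₀ := by
            rintro rfl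
            obtain ⟨t₁, v₁, hd, hc⟩ := critical_eq hT hV h2
            -- So far `t₀` is only the possible exception in `ht₀`. Some tetrahedron is critical and
            -- all others are paired, so it is `t₀` that is critical.
            obtain ⟨t₂, ht₂⟩ := exists_critical_tet hT hV
            by_cases h' : t₂ = a
            · subst h'; exact (mem_critical_iff.1 ht₂ _).2 hp
            · obtain ⟨k, hk⟩ := ht₀ t₂ h'
              exact (mem_critical_iff.1 ht₂ _).2 hk
          refine ⟨ha, fun h => ?_⟩
          have e := (V.disjoint _ _ _ _ hp (hpair ⟨a, h⟩) (Or.inr (Or.inr (Or.inr rfl)))).1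
          have hg' := hglue ⟨a, h⟩
          rcases mkTriangle_eq_iff.1 e with ⟨-, e'⟩ | ⟨q', hq', -⟩
          · rw [e', hg] at hg'
            exact (Prod.mk.inj (Option.some.inj hg')).1.symm
          · exact absurd rfl (ne_of_tet_pair hV hp hq')
        obtain ⟨hab, j, q, hg⟩ := he
        obtain ⟨hF, hg⟩ := restrict_glue_eq_some.1 hg
        rcases mem_dualForest_cases hF hg with h | h
        · obtain ⟨ha, h'⟩ := main a b j q hg h
          exact ⟨⟨a, ha⟩, Subtype.ext (congrArg (fun z => s(a, z)) (h' ha))⟩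
        · rw [mkTriangle_glue hg] at h
          obtain ⟨hb, h'⟩ := main b a _ _ (T.glue_symm _ _ _ _ hg) h
          exact ⟨⟨b, hb⟩, Subtype.ext ((congrArg (fun z => s(b, z)) (h' hb)).trans Sym2.eq_swap)⟩
    have h3 : Nat.card {t // t ≠ t₀} + 1 = Nat.card τ := by
      have := Set.ncard_add_ncard_compl ({t₀} : Set τ)
      rw [Set.ncard_singleton, ← Nat.card_coe_set_eq, add_comm] at this
      exact this
    omega
  · intro t j q hg
    obtain ⟨hF, hg⟩ := restrict_glue_eq_some.1 hg
    exact mem_dualForest_ne hV hF hg rfl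
  · intro t w j k q r hg hg'
    obtain ⟨hF, hg⟩ := restrict_glue_eq_some.1 hg
    obtain ⟨hF', hg'⟩ := restrict_glue_eq_some.1 hg'
    by_contra hjk
    have hne' := mem_dualForest_ne hV hF hg
    have hnt : T.mkTriangle t j ≠ T.mkTriangle t k := by
      intro h
      rcases mkTriangle_eq_iff.1 h with ⟨-, h⟩ | ⟨s, hs, -⟩
      · exact hjk h.symm
      · exact mem_dualForest_ne hV hF hs rfl
    have main : ∀ x, (T.mkTriangle t j, x) ∈ V.pairs → (T.mkTriangle t k, x) ∈ V.pairs → False :=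
      fun x h1 h2 => hnt (V.disjoint _ _ _ _ h1 h2 (Or.inr (Or.inr (Or.inr rfl)))).1
    rcases mem_dualForest_cases hF hg with h | h <;>
      rcases mem_dualForest_cases hF' hg' with h' | h'
    · exact main _ h h'
    · rw [mkTriangle_glue hg'] at h'
      exact hV _ ((step_of_tet_pair h hg).trans
        (step_of_tet_pair h' (T.glue_symm _ _ _ _ hg')))
    · rw [mkTriangle_glue hg] at h
      exact hV _ ((step_of_tet_pair h' hg').trans
        (step_of_tet_pair h (T.glue_symm _ _ _ _ hg)))
    · exact main _ h h'

/-- The middle pairs can be listed in an order compatible with the walks. -/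
lemma exists_enumeration [Finite τ] (hV : V.IsAcyclic) :
    ∃ (n : ℕ) (P : Fin n → T.Simplex × T.Simplex), Function.Injective P ∧
      Set.range P = V.middlePairs ∧ ∀ s s', s ≤ s' → ¬ TransGen V.Step (P s').2 (P s).2 := by
  classical
  let n := Nat.card V.middlePairs
  let e : Fin n ≃ V.middlePairs := (Finite.equivFin _).symm
  -- The number of simplices from which the triangle is reached; by acyclicity it strictly increases
  -- along walks, so sorting by it gives the order.
  let f : Fin n → ℕ := fun s => {y | TransGen V.Step y (e s).1.2}.ncard
  refine ⟨n, fun s => (e (Tuple.sort f s)).1, ?_, ?_, ?_⟩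
  · exact Subtype.val_injective.comp (e.injective.comp (Tuple.sort f).injective)
  · ext x
    constructor
    · rintro ⟨s, rfl⟩
      exact (e _).2
    · intro hx
      exact ⟨(Tuple.sort f).symm (e.symm ⟨x, hx⟩), by simp⟩
  · intro s s' hs h
    have h1 : f (Tuple.sort f s) ≤ f (Tuple.sort f s') := Tuple.monotone_sort f hs
    refine absurd h1 (not_le.2 ?_)
    refine Set.ncard_lt_ncard ⟨fun y hy => TransGen.trans hy h, fun hsub => ?_⟩ (Set.toFinite _)
    exact hV _ (hsub h)

end DiscreteVectorField

/-! ### From a gradient to a local construction -/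

variable {T : Gluing τ}

namespace DiscreteVectorField

variable {V : T.DiscreteVectorField}

lemma middlePair_coords {x : T.Simplex × T.Simplex} (hx : x ∈ V.middlePairs) :
    ∃ t i a b, a ≠ b ∧ a ≠ i ∧ b ≠ i ∧ x = (T.mkEdge t a b, T.mkTriangle t i) := by
  obtain ⟨e, f⟩ := x
  obtain ⟨h1, h2⟩ := hx
  rcases (V.isFacetOf _ _ h1).cases with ⟨u, i, rfl, rfl⟩ |
      ⟨u, i, a, b, hab, ha, hb, rfl, rfl⟩ | ⟨u, a, b, hab, rfl, rfl⟩
  · simp at h2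
  · exact ⟨u, i, a, b, hab, ha, hb, rfl⟩
  · simp at h2

/-- An edge oriented towards a triangle occurs only once in its boundary. -/
lemma eq_pair_of_middle (hV : V.IsAcyclic) {t : τ} {i a b c d : Fin 4}
    (hab : a ≠ b) (ha : a ≠ i) (hb : b ≠ i) (hc : c ≠ i) (hd : d ≠ i)
    (hp : (T.mkEdge t a b, T.mkTriangle t i) ∈ V.pairs)
    (h : T.mkEdge t a b = T.mkEdge t c d) : ({c, d} : Finset (Fin 4)) = {a, b} := by
  by_contra hne
  exact hV (T.mkEdge t a b) (TransGen.head (Or.inl hp) (TransGen.single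
    (step_triangle V t hab ha hb fun _ => ⟨c, d, hc, hd, hne, h⟩)))

/-- A triangle containing an edge oriented towards another triangle precedes that triangle. -/
lemma transGen_of_middle {t : τ} {i a b : Fin 4} {f : T.Simplex}
    (hab : a ≠ b) (ha : a ≠ i) (hb : b ≠ i) (hp : (T.mkEdge t a b, f) ∈ V.pairs)
    (hne : T.mkTriangle t i ≠ f) : TransGen V.Step (T.mkTriangle t i) f := by
  refine TransGen.head (step_triangle V t hab ha hb fun h => ?_) (TransGen.single (Or.inl hp))
  exact absurd (V.disjoint _ _ _ _ h hp (Or.inl rfl)).2 hne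

/-- The directed edges of a glued triangle that represent its chosen edge. -/
lemma eq_flag_of_middle (hT : T.IsClosedTriangulation) (hV : V.IsAcyclic) {t u : τ}
    {i a b : Fin 4} {p : Equiv.Perm (Fin 4)}
    (hab : a ≠ b) (ha : a ≠ i) (hb : b ≠ i)
    (hp : (T.mkEdge t a b, T.mkTriangle t i) ∈ V.pairs) (hg : T.glue t i = some (u, p))
    {y : (τ × Fin 4 × Fin 4) × Fin 4} (hy : y ∈ T.edgeFlags (t, a, b))
    (hf : T.mkTriangle t i = T.mkTriangle y.1.1 y.2) :
    y = ((t, a, b), i) ∨ y = ((u, p a, p b), p i) := by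
  obtain ⟨⟨w, c, d⟩, j⟩ := y
  obtain ⟨hs, hjc, hjd⟩ := hy
  simp only at hs hjc hjd hf
  have key : ∀ c d, i ≠ c → i ≠ d → T.SameDirEdge (t, a, b) (t, c, d) → c = a ∧ d = b := by
    intro c d hc hd h
    rcases pair_eq_pair (eq_pair_of_middle hV hab ha hb hc.symm hd.symm hp h.mkEdge_eq).symm with
      h' | ⟨rfl, rfl⟩
    · exact h'
    · exact absurd h (hT.nondegenerate _ _ _ hab)
  rcases mkTriangle_eq_iff.1 hf with ⟨rfl, rfl⟩ | ⟨q, hq, rfl⟩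
  · obtain ⟨rfl, rfl⟩ := key c d hjc hjd hs
    exact Or.inl rfl
  · rw [hg] at hq
    obtain ⟨rfl, rfl⟩ := Prod.mk.inj (Option.some.inj hq)
    have h1 : T.SameDirEdge (t, a, b) (t, p⁻¹ c, p⁻¹ d) :=
      EqvGen.trans _ _ _ hs
        (EqvGen.rel _ _ ⟨p i, p⁻¹, T.glue_symm _ _ _ _ hg, hjc, hjd, rfl, rfl⟩)
    obtain ⟨h2, h3⟩ := key _ _ (fun h => hjc (by rw [h]; simp)) (fun h => hjd (by rw [h]; simp)) h1
    right
    rw [← h2, ← h3]; simp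

/-- A Morse gradient with two critical simplices gives a local construction. -/
lemma exists_localConstruction [Finite τ] (hT : T.IsClosedTriangulation) (hV : V.IsAcyclic)
    (h2 : V.critical.ncard = 2) :
    ∃ c : T.LocalConstruction, V.dualForest = c.baseTriangles ∧ V.edgeForest = c.criticalTree ∧
      V.middlePairs = Set.range fun s => (c.chosenEdge s, c.chosenTriangle s) := by
  obtain ⟨n, P, hinj, hran, hord⟩ := exists_enumeration hV
  have hmem : ∀ s, P s ∈ V.middlePairs := fun s => hran ▸ Set.mem_range_self s
  choose t i a b hab ha hb hP using fun s => middlePair_coords (hmem s)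
  have hpair : ∀ s, (T.mkEdge (t s) (a s) (b s), T.mkTriangle (t s) (i s)) ∈ V.pairs :=
    fun s => hP s ▸ (hmem s).1
  have hP2 : ∀ s, (P s).2 = T.mkTriangle (t s) (i s) := fun s => by rw [hP s]
  choose u p hg using fun s => hT.exists_glue (t s) (i s)
  -- The triangles glued at stage `s`: those of the tree and those of the pairs with index strictly
  -- below `s`, so that stage 0 is the tree alone.
  let F : Fin (n + 1) → Set T.Simplex := fun s =>
    {f | f ∈ V.dualForest ∨ ∃ r : Fin n, r.castSucc < s ∧ (P r).2 = f}
  have hF0 : F 0 = V.dualForest := by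
    ext f
    exact ⟨fun h => h.resolve_right fun ⟨r, hr, _⟩ => absurd hr (Fin.not_lt_zero _), Or.inl⟩
  have hinj2 : ∀ r s, (P r).2 = (P s).2 → r = s := fun r s h => hinj (Prod.ext
    (V.disjoint _ _ _ _ (hmem r).1 (hmem s).1 (Or.inr (Or.inr (Or.inr h)))).1 h)
  have hnot : ∀ s : Fin n, T.mkTriangle (t s) (i s) ∉ F s.castSucc := by
    rintro s (h | ⟨r, hr, h⟩)
    · exact not_dual_of_middle (hmem s) (hP2 s ▸ h)
    · rw [← hP2 s] at h
      rw [hinj2 _ _ h] at hr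
      exact lt_irrefl _ hr
  have hsucc : ∀ (s : Fin n) f, f ∈ F s.succ ↔ f ∈ F s.castSucc ∨ f = (P s).2 := by
    intro s f
    constructor
    · rintro (h | ⟨r, hr, h⟩)
      · exact Or.inl (Or.inl h)
      · rcases (Fin.castSucc_lt_succ_iff.1 hr).lt_or_eq with h' | rfl
        · exact Or.inl (Or.inr ⟨r, Fin.castSucc_lt_castSucc_iff.2 h', h⟩)
        · exact Or.inr h.symm
    · rintro ((h | ⟨r, hr, h⟩) | rfl)
      · exact Or.inl h
      · exact Or.inr ⟨r, hr.trans s.castSucc_lt_succ, h⟩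
      · exact Or.inr ⟨s, s.castSucc_lt_succ, rfl⟩
  have hcov : ∀ f : T.Simplex, f.dim = 2 → f ∈ V.dualForest ∨ ∃ r, (P r).2 = f := by
    intro f hf
    rcases dual_or_middle hT hV h2 hf with h | ⟨x, hx, rfl⟩
    · exact Or.inl h
    · rw [← hran] at hx
      obtain ⟨r, rfl⟩ := hx
      exact Or.inr ⟨r, rfl⟩
  let c : T.LocalConstruction :=
    { numSteps := n
      stage := fun s => T.restrict (F s)
      move := fun s => ⟨t s, i s, u s, p s, a s, b s⟩
      base_tree := by
        rw [hF0]; exact isTreeOfTetrahedra hT hV h2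
      allowed := by
        intro s
        have hb1 : (T.restrict (F s.castSucc)).glue (t s) (i s) = none :=
          restrict_glue_of_not_mem (hnot s)
        refine ⟨hb1, ?_, ?_, hab s, ha s, hb s, ?_⟩
        · exact restrict_glue_of_not_mem (mkTriangle_glue (hg s) ▸ hnot s)
        · exact (T.glue_ne _ _ _ _ (hg s)).symm
        -- An unglued triangle around the edge, other than the one about to be glued, would belong
        -- to a pair `r` with `s ≤ r`. But it steps down to the edge and from there to the triangle
        -- of pair `s`, against the order of the enumeration.
        · refine sameDirEdge_of_boundary (hab s) (ha s) (hb s) hb1 ?_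
          intro y hy hnone
          have hs : T.SameDirEdge (t s, a s, b s) y.1 :=
            hy.1.mono fun _ _ _ h => (restrict_glue_eq_some.1 h).2
          refine eq_flag_of_middle hT hV (hab s) (ha s) (hb s) (hpair s) (hg s)
            ⟨hs, hy.2⟩ ?_
          rw [restrict_glue_eq_none hT] at hnone
          by_contra hne
          obtain ⟨r, hr⟩ := (hcov _ (dim_mkTriangle y.1.1 y.2)).resolve_left
            fun h => hnone (Or.inl h)
          have hsr : s ≤ r := by
            by_contra hlt
            exact hnone (Or.inr ⟨r, Fin.castSucc_lt_castSucc_iff.2 (not_le.1 hlt), hr⟩)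
          refine hord s r hsr ?_
          rw [hr, hP2]
          refine transGen_of_middle (hs.ne_iff.1 (hab s)) hy.2.1.symm hy.2.2.symm ?_
            (Ne.symm hne)
          rw [← hs.mkEdge_eq]
          exact hpair s
      result := by
        intro s
        refine ⟨?_, ?_⟩
        · rw [← hg s]
          exact restrict_glue_of_mem ((hsucc _ _).2 (Or.inr (hP2 s).symm))
        · intro w j h1 h2
          have : T.mkTriangle w j ≠ (P s).2 := by
            intro h
            rw [hP2] at h
            rcases mkTriangle_eq_iff.1 h.symm with ⟨rfl, rfl⟩ | ⟨q, hq, rfl⟩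
            · exact h1 rfl
            · rw [hg s] at hq
              obtain ⟨rfl, rfl⟩ := Prod.mk.inj (Option.some.inj hq)
              exact h2 rfl
          by_cases hm : T.mkTriangle w j ∈ F s.castSucc
          · rw [restrict_glue_of_mem hm, restrict_glue_of_mem ((hsucc _ _).2 (Or.inl hm))]
          · rw [restrict_glue_of_not_mem hm, restrict_glue_of_not_mem fun h =>
              ((hsucc _ _).1 h).elim hm this]
      final := by
        ext w j q
        rw [restrict_glue_of_mem]
        rcases hcov _ (dim_mkTriangle w j) with h | ⟨r, h⟩
        · exact Or.inl h
        · exact Or.inr ⟨r, Fin.castSucc_lt_last r, h⟩ }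
  have hran' : V.middlePairs = Set.range fun s => (c.chosenEdge s, c.chosenTriangle s) := by
    rw [← hran]
    congr 1
    funext s
    exact hP s
  refine ⟨c, ?_, ?_, hran'⟩
  · have hbase : c.base = T.restrict V.dualForest := by rw [← hF0]; rfl
    ext f
    constructor
    · intro hf
      obtain ⟨w, j, rfl⟩ := eq_mkTriangle_of_dim hf.1
      refine ⟨w, j, ?_, rfl⟩
      rw [hbase, Ne, restrict_glue_eq_none hT]
      exact not_not.2 hf
    · rintro ⟨w, j, h, rfl⟩
      rw [hbase, Ne, restrict_glue_eq_none hT] at h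
      exact not_not.1 h
  · ext e
    constructor
    · intro he
      refine ⟨he.1, fun s => (edge_or_middle hT hV h2 he.1).1 he
        (c.chosenEdge s, c.chosenTriangle s) ?_⟩
      rw [hran']
      exact ⟨s, rfl⟩
    · rintro ⟨hd, h⟩
      refine (edge_or_middle hT hV h2 hd).2 fun x hx => ?_
      rw [hran'] at hx
      obtain ⟨s, rfl⟩ := hx
      exact h s

end DiscreteVectorField

/-! ### Chosen edges and triangles of a local construction -/

lemma mem_iff_of_eqvGen {α : Type*} {r : α → α → Prop} {S : Set α}
    (h : ∀ z w, r z w → (z ∈ S ↔ w ∈ S)) {x y : α} (hxy : EqvGen r x y) : x ∈ S ↔ y ∈ S := by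
  induction hxy with
  | rel x y h' => exact h _ _ h'
  | refl x => rfl
  | symm x y _ ih => exact ih.symm
  | trans x y z _ _ ih1 ih2 => exact ih1.trans ih2

namespace LocalConstruction

variable (c : T.LocalConstruction)

/-- A move changes only two boundary triangles, so no gluing is ever undone. -/
lemma stage_mono {s s' : Fin (c.numSteps + 1)} (h : s ≤ s') {t : τ} {i : Fin 4}
    {q : τ × Equiv.Perm (Fin 4)} (hq : (c.stage s).glue t i = some q) :
    (c.stage s').glue t i = some q := by
  have key : Monotone fun s : Fin (c.numSteps + 1) =>
      {x : (τ × Fin 4) × (τ × Equiv.Perm (Fin 4)) | (c.stage s).glue x.1.1 x.1.2 = some x.2} := by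
    rw [Fin.monotone_iff_le_succ]
    rintro r ⟨⟨t, i⟩, q⟩ hx
    change (c.stage r.castSucc).glue t i = some q at hx
    change (c.stage r.succ).glue t i = some q
    rw [(c.result r).unchanged t i, hx]
    · rintro h
      obtain ⟨rfl, rfl⟩ := Prod.mk.inj h
      rw [(c.allowed r).boundary₁] at hx
      cases hx
    · rintro h
      obtain ⟨rfl, rfl⟩ := Prod.mk.inj h
      rw [(c.allowed r).boundary₂] at hx
      cases hx
  exact @key _ _ h ((t, i), q) hq

lemma glue_of_stage {s : Fin (c.numSteps + 1)} {t : τ} {i : Fin 4}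
    {q : τ × Equiv.Perm (Fin 4)} (hq : (c.stage s).glue t i = some q) : T.glue t i = some q := by
  have := c.stage_mono (Fin.le_last s) hq
  rwa [c.final] at this

lemma glue_move (s : Fin c.numSteps) :
    T.glue (c.move s).tet₁ (c.move s).facet = some ((c.move s).tet₂, (c.move s).perm) :=
  c.glue_of_stage (c.result s).glued

/-- The directed edge chosen at a step. -/
def dirEdge (s : Fin c.numSteps) : τ × Fin 4 × Fin 4 :=
  ((c.move s).tet₁, (c.move s).a, (c.move s).b)

/-- The first flag at the chosen edge of a step. -/
def flag₁ (s : Fin c.numSteps) : (τ × Fin 4 × Fin 4) × Fin 4 :=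
  (c.dirEdge s, (c.move s).facet)

/-- The second flag at the chosen edge of a step. -/
def flag₂ (s : Fin c.numSteps) : (τ × Fin 4 × Fin 4) × Fin 4 :=
  (((c.move s).tet₂, (c.move s).perm (c.move s).a, (c.move s).perm (c.move s).b),
    (c.move s).perm (c.move s).facet)

/-- Since the chosen edge is shared, the two triangles of the move give two distinct boundary points
of one link, and a link has no others. -/
lemma boundary_cases [Finite τ] (s : Fin c.numSteps) {y : (τ × Fin 4 × Fin 4) × Fin 4}
    (hy : y ∈ (c.stage s.castSucc).edgeFlags (c.dirEdge s))
    (h : (c.stage s.castSucc).glue y.1.1 y.2 = none) : y = c.flag₁ s ∨ y = c.flag₂ s := by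
  have ha := c.allowed s
  refine boundary_edgeFlags (G := c.stage s.castSucc) (x := c.dirEdge s) ha.a_ne_b ?_ ?_ ?_ hy
    ha.boundary₁ ha.boundary₂ h
  · intro h
    apply ha.distinct
    exact Prod.ext (congrArg (fun z : (τ × Fin 4 × Fin 4) × Fin 4 => z.1.1) h)
      (congrArg (fun z : (τ × Fin 4 × Fin 4) × Fin 4 => z.2) h)
  · exact ⟨EqvGen.refl _, ha.a_ne_facet.symm, ha.b_ne_facet.symm⟩
  · exact ⟨ha.shared, fun h => ha.a_ne_facet ((c.move s).perm.injective h).symm,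
      fun h => ha.b_ne_facet ((c.move s).perm.injective h).symm⟩

/-- The chosen edge becomes interior: its class in `T` is its class before the step. -/
lemma sameDirEdge_stage [Finite τ] (s : Fin c.numSteps) {z : τ × Fin 4 × Fin 4}
    (h : T.SameDirEdge (c.dirEdge s) z) : (c.stage s.castSucc).SameDirEdge (c.dirEdge s) z := by
  -- The class before the step is already closed under the identifications of `T`: a triangle around
  -- it is either glued, or is one of the two sides which the move glues to each other.
  have key : ∀ z w, T.DirEdgeIdent z w → (c.stage s.castSucc).SameDirEdge (c.dirEdge s) z →
      (c.stage s.castSucc).SameDirEdge (c.dirEdge s) w := by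
    rintro z w ⟨i, p, hg, ha, hb, h1, h2⟩ hz
    rcases hq : (c.stage s.castSucc).glue z.1 i with _ | q
    · rcases c.boundary_cases s (y := (z, i)) ⟨hz, ha, hb⟩ hq with h | h
      · obtain ⟨rfl, rfl⟩ := Prod.mk.inj h
        have hm := c.glue_move s
        rw [show T.glue (c.move s).tet₁ (c.move s).facet = some (w.1, p) from hg] at hm
        obtain ⟨h3, rfl⟩ := Prod.mk.inj (Option.some.inj hm)
        have : w = (c.flag₂ s).1 := Prod.ext h3 (Prod.ext h1 h2)
        rw [this]
        exact (c.allowed s).shared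
      · obtain ⟨rfl, rfl⟩ := Prod.mk.inj h
        have hm := T.glue_symm _ _ _ _ (c.glue_move s)
        rw [show T.glue (c.move s).tet₂ ((c.move s).perm (c.move s).facet) = some (w.1, p)
          from hg] at hm
        obtain ⟨h3, rfl⟩ := Prod.mk.inj (Option.some.inj hm)
        have : w = c.dirEdge s := by
          refine Prod.ext h3 (Prod.ext ?_ ?_)
          · rw [h1]; simp [dirEdge]
          · rw [h2]; simp [dirEdge]
        rw [this]
        exact EqvGen.refl _
    · have := c.glue_of_stage hq
      rw [hg] at this
      obtain rfl := Option.some.inj this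
      exact EqvGen.trans _ _ _ hz (EqvGen.rel _ _ ⟨i, p, hq, ha, hb, h1, h2⟩)
  exact (mem_iff_of_eqvGen (S := {z | (c.stage s.castSucc).SameDirEdge (c.dirEdge s) z})
    (fun z w hzw => ⟨key z w hzw, key w z hzw.symm⟩) h).1 (EqvGen.refl _)

/-- The class of the chosen edge no longer grows, so the boundary count made before the step also
controls all triangles around the edge in `T`. The triangular incidence of chosen edges and
triangles rests on this. -/
lemma flag_cases [Finite τ] (s : Fin c.numSteps) {y : (τ × Fin 4 × Fin 4) × Fin 4}
    (hy : y ∈ T.edgeFlags (c.dirEdge s)) (h : (c.stage s.castSucc).glue y.1.1 y.2 = none) :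
    y = c.flag₁ s ∨ y = c.flag₂ s :=
  c.boundary_cases s ⟨c.sameDirEdge_stage s hy.1, hy.2⟩ h

lemma succ_glue_of_flag (s : Fin c.numSteps) {y : (τ × Fin 4 × Fin 4) × Fin 4}
    (h : y = c.flag₁ s ∨ y = c.flag₂ s) : (c.stage s.succ).glue y.1.1 y.2 ≠ none := by
  have hg := (c.result s).glued
  rcases h with rfl | rfl
  · change (c.stage s.succ).glue (c.move s).tet₁ (c.move s).facet ≠ none
    rw [hg]; simp
  · change (c.stage s.succ).glue (c.move s).tet₂ ((c.move s).perm (c.move s).facet) ≠ none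
    rw [(c.stage s.succ).glue_symm _ _ _ _ hg]; simp

lemma stage_ne_none_mono {s s' : Fin (c.numSteps + 1)} (h : s ≤ s') {t : τ} {i : Fin 4}
    (hq : (c.stage s).glue t i ≠ none) : (c.stage s').glue t i ≠ none := by
  obtain ⟨q, hq⟩ := Option.ne_none_iff_exists'.1 hq
  rw [c.stage_mono h hq]; simp

lemma chosenTriangle_cases (s : Fin c.numSteps) {t : τ} {i : Fin 4}
    (h : T.mkTriangle t i = c.chosenTriangle s) :
    (t = (c.move s).tet₁ ∧ i = (c.move s).facet) ∨
      (t = (c.move s).tet₂ ∧ i = (c.move s).perm (c.move s).facet) := by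
  rcases mkTriangle_eq_iff.1 h.symm with h | ⟨p, hp, h⟩
  · exact Or.inl h
  · rw [c.glue_move s] at hp
    obtain ⟨rfl, rfl⟩ := Prod.mk.inj (Option.some.inj hp)
    exact Or.inr ⟨rfl, h⟩

lemma castSucc_glue (s : Fin c.numSteps) {t : τ} {i : Fin 4}
    (h : T.mkTriangle t i = c.chosenTriangle s) : (c.stage s.castSucc).glue t i = none := by
  rcases c.chosenTriangle_cases s h with ⟨rfl, rfl⟩ | ⟨rfl, rfl⟩
  · exact (c.allowed s).boundary₁
  · exact (c.allowed s).boundary₂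

lemma succ_glue (s : Fin c.numSteps) {t : τ} {i : Fin 4}
    (h : T.mkTriangle t i = c.chosenTriangle s) : (c.stage s.succ).glue t i ≠ none := by
  rcases c.chosenTriangle_cases s h with ⟨rfl, rfl⟩ | ⟨rfl, rfl⟩
  · exact c.succ_glue_of_flag s (y := c.flag₁ s) (Or.inl rfl)
  · exact c.succ_glue_of_flag s (y := c.flag₂ s) (Or.inr rfl)

lemma stage_cases (s : Fin (c.numSteps + 1)) (t : τ) (i : Fin 4)
    (h : (c.stage s).glue t i ≠ none) :
    c.base.glue t i ≠ none ∨ ∃ r, T.mkTriangle t i = c.chosenTriangle r := by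
  induction s using Fin.induction with
  | zero => exact Or.inl h
  | succ s ih =>
    by_cases h1 : (t, i) = ((c.move s).tet₁, (c.move s).facet)
    · obtain ⟨rfl, rfl⟩ := Prod.mk.inj h1
      exact Or.inr ⟨s, rfl⟩
    by_cases h2 : (t, i) = ((c.move s).tet₂, (c.move s).perm (c.move s).facet)
    · obtain ⟨rfl, rfl⟩ := Prod.mk.inj h2
      exact Or.inr ⟨s, (mkTriangle_glue (c.glue_move s)).symm⟩
    · rw [(c.result s).unchanged t i h1 h2] at h
      exact ih h

/-- `T` prescribes the gluing maps, so the base is determined by the triangles glued in it. This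
allows bases to be compared through sets of triangles of `T`. -/
lemma base_eq_restrict : c.base = T.restrict c.baseTriangles := by
  ext t i q
  by_cases hm : T.mkTriangle t i ∈ c.baseTriangles
  · rw [restrict_glue_of_mem hm]
    suffices h : c.base.glue t i ≠ none by
      obtain ⟨q', hq'⟩ := Option.ne_none_iff_exists'.1 h
      rw [hq', c.glue_of_stage hq']
    obtain ⟨u, j, h, e⟩ := hm
    rcases mkTriangle_eq_iff.1 e.symm with ⟨rfl, rfl⟩ | ⟨p, hp, rfl⟩
    · exact h
    · obtain ⟨q', hq'⟩ := Option.ne_none_iff_exists'.1 h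
      have := c.glue_of_stage hq'
      rw [hp] at this
      obtain rfl := Option.some.inj this
      rw [c.base.glue_symm _ _ _ _ hq']; simp
  · rw [restrict_glue_of_not_mem hm]
    suffices h : c.base.glue t i = none by rw [h]
    by_contra h
    exact hm ⟨t, i, h, rfl⟩

lemma triangle_cases (hT : T.IsClosedTriangulation) {f : T.Simplex} (hf : f.dim = 2) :
    f ∈ c.baseTriangles ∨ ∃ r, f = c.chosenTriangle r := by
  obtain ⟨t, i, rfl⟩ := eq_mkTriangle_of_dim hf
  have : (c.stage (Fin.last _)).glue t i ≠ none := by rw [c.final]; exact hT.closed t i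
  rcases c.stage_cases _ t i this with h | h
  · exact Or.inl ⟨t, i, h, rfl⟩
  · exact Or.inr h

lemma chosenTriangle_not_mem (s : Fin c.numSteps) : c.chosenTriangle s ∉ c.baseTriangles := by
  rintro ⟨t, i, h, e⟩
  exact c.stage_ne_none_mono (Fin.zero_le _) h (c.castSucc_glue s e.symm)

lemma chosenTriangle_injective : Function.Injective c.chosenTriangle := by
  have key : ∀ r s, r < s → c.chosenTriangle r ≠ c.chosenTriangle s := fun r s hrs h =>
    c.stage_ne_none_mono (Fin.le_castSucc_iff.2 (Fin.succ_lt_succ_iff.2 hrs))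
      (c.succ_glue r rfl) (c.castSucc_glue s h)
  intro r s h
  rcases lt_trichotomy r s with h' | h' | h'
  · exact absurd h (key _ _ h')
  · exact h'
  · exact absurd h.symm (key _ _ h')

/-- Two representations of the chosen edge differ at most by their direction. -/
lemma mem_edgeFlags_of_chosenEdge {s : Fin c.numSteps} {t : τ} {i a b : Fin 4}
    (ha : a ≠ i) (hb : b ≠ i) (h : T.mkEdge t a b = c.chosenEdge s) :
    ((t, a, b), i) ∈ T.edgeFlags (c.dirEdge s) ∨ ((t, b, a), i) ∈ T.edgeFlags (c.dirEdge s) := by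
  rcases sameDirEdge_of_mkEdge_eq h with h | h
  · exact Or.inl ⟨EqvGen.symm _ _ h, ha.symm, hb.symm⟩
  · exact Or.inr ⟨EqvGen.symm _ _ h, hb.symm, ha.symm⟩

/-- The chosen edge of a step is not contained in the triangles that are glued later. -/
lemma le_of_chosenEdge [Finite τ] {r s : Fin c.numSteps} {t : τ} {i a b : Fin 4}
    (ha : a ≠ i) (hb : b ≠ i) (he : T.mkEdge t a b = c.chosenEdge s)
    (hf : T.mkTriangle t i = c.chosenTriangle r) : r ≤ s := by
  by_contra hlt
  have hle : s.succ ≤ r.castSucc := Fin.le_castSucc_iff.2 (Fin.succ_lt_succ_iff.2 (not_le.1 hlt))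
  -- Every triangle around the chosen edge of step `s` is glued once that step is done, whereas the
  -- triangle of step `r` is still on the boundary just before step `r`.
  have key : ∀ a b, ((t, a, b), i) ∈ T.edgeFlags (c.dirEdge s) → False := by
    intro a b hy
    refine c.stage_ne_none_mono hle ?_ (c.castSucc_glue r hf)
    by_cases h : (c.stage s.castSucc).glue t i = none
    · exact c.succ_glue_of_flag s (c.flag_cases s hy h)
    · exact c.stage_ne_none_mono s.castSucc_lt_succ.le h
  exact (c.mem_edgeFlags_of_chosenEdge ha hb he).elim (key _ _) (key _ _)

/-- The chosen edge of a step occurs only once in the triangle glued at that step. -/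
lemma pair_eq_of_chosenEdge [Finite τ] {s : Fin c.numSteps} {t : τ} {i a b a' b' : Fin 4}
    (ha : a ≠ i) (hb : b ≠ i) (ha' : a' ≠ i) (hb' : b' ≠ i)
    (he : T.mkEdge t a b = c.chosenEdge s) (he' : T.mkEdge t a' b' = c.chosenEdge s)
    (hf : T.mkTriangle t i = c.chosenTriangle s) :
    ({a, b} : Finset (Fin 4)) = {a', b'} := by
  have h0 := c.castSucc_glue s hf
  -- The two flags lie on different sides of the glued triangle, so one side carries only one of
  -- them.
  have hne : (c.flag₁ s).1.1 = (c.flag₂ s).1.1 → (c.flag₁ s).2 ≠ (c.flag₂ s).2 :=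
    fun h1 h2 => (c.allowed s).distinct (Prod.ext h1 h2)
  have key : ∀ a b a' b', ((t, a, b), i) ∈ T.edgeFlags (c.dirEdge s) →
      ((t, a', b'), i) ∈ T.edgeFlags (c.dirEdge s) →
      ({a, b} : Finset (Fin 4)) = {a', b'} := by
    intro a b a' b' hy hy'
    suffices h : ((t, a, b), i) = ((t, a', b'), i) by
      simp only [Prod.mk.injEq, true_and, and_true] at h
      rw [h.1, h.2]
    rcases c.flag_cases s hy h0 with h | h <;> rcases c.flag_cases s hy' h0 with h' | h'
    · rw [h, h']
    · rw [← h, ← h'] at hne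
      exact absurd rfl (hne rfl)
    · rw [← h, ← h'] at hne
      exact absurd rfl (hne rfl)
    · rw [h, h']
  rcases c.mem_edgeFlags_of_chosenEdge ha hb he with h | h <;>
    rcases c.mem_edgeFlags_of_chosenEdge ha' hb' he' with h' | h'
  · exact key _ _ _ _ h h'
  · rw [key _ _ _ _ h h', pair_comm]
  · rw [pair_comm, key _ _ _ _ h h']
  · rw [pair_comm, key _ _ _ _ h h', pair_comm]

lemma chosenEdge_injective [Finite τ] : Function.Injective c.chosenEdge := by
  have key : ∀ r s, c.chosenEdge r = c.chosenEdge s → r ≤ s := fun r s h =>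
    c.le_of_chosenEdge (c.allowed r).a_ne_facet (c.allowed r).b_ne_facet h rfl
  exact fun r s h => le_antisymm (key _ _ h) (key _ _ h.symm)

lemma dim_chosenEdge (s : Fin c.numSteps) : (c.chosenEdge s).dim = 1 :=
  dim_mkEdge _ (c.allowed s).a_ne_b

/-- The middle pairs are determined by the two forests. -/
lemma middlePairs_eq [Finite τ] (hT : T.IsClosedTriangulation) {V : T.DiscreteVectorField}
    (hV : V.IsAcyclic) (h2 : V.critical.ncard = 2) (hd : V.dualForest = c.baseTriangles)
    (he : V.edgeForest = c.criticalTree) :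
    V.middlePairs = Set.range fun s => (c.chosenEdge s, c.chosenTriangle s) := by
  have htri : ∀ x ∈ V.middlePairs, ∃ r, x.2 = c.chosenTriangle r := by
    intro x hx
    have h := DiscreteVectorField.not_dual_of_middle hx
    rw [hd] at h
    refine (c.triangle_cases hT ?_).resolve_left h
    rw [DiscreteVectorField.dim_eq_of_mem hx.1, hx.2]
  -- The partner of the edge chosen at step `s` is a triangle containing it, glued at some step `r ≤
  -- s`. By induction the triangles of earlier steps are taken by their own edges, so `r = s`.
  have key : ∀ s, (c.chosenEdge s, c.chosenTriangle s) ∈ V.middlePairs := by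
    intro s
    induction s using WellFoundedLT.induction with
    | ind s ih =>
      have hn : ¬ ∀ x ∈ V.middlePairs, x.1 ≠ c.chosenEdge s := by
        rw [← DiscreteVectorField.edge_or_middle hT hV h2 (c.dim_chosenEdge s), he]
        exact fun h => h.2 s rfl
      push Not at hn
      obtain ⟨x, hx, hx1⟩ := hn
      obtain ⟨r, hr⟩ := htri x hx
      obtain ⟨t, i, a, b, hab, ha, hb, rfl⟩ := DiscreteVectorField.middlePair_coords hx
      simp only at hr hx1
      rcases (c.le_of_chosenEdge ha hb hx1 hr).lt_or_eq with h | rfl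
      · have := (V.disjoint _ _ _ _ (ih r h).1 hx.1 (Or.inr (Or.inr (Or.inr hr.symm)))).1
        exact absurd (c.chosenEdge_injective (this.trans hx1)) h.ne
      · rw [← hx1, ← hr]
        exact hx
  ext x
  constructor
  · intro hx
    obtain ⟨r, hr⟩ := htri x hx
    exact ⟨r, Prod.ext (V.disjoint _ _ _ _ (key r).1 hx.1 (Or.inr (Or.inr (Or.inr hr.symm)))).1
      hr.symm⟩
  · rintro ⟨s, rfl⟩
    exact key s

end LocalConstruction

/-! ### Rooted forests and two-to-one counts -/

/-- Rooted spanning forests: in a (multi)graph in which every vertex is joined to a root, every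
other vertex has a parent edge leading to a vertex of smaller depth, and the parent edges of
different vertices are different. -/
lemma exists_rooted_forest {X Y : Type*} {inc : Y → X → X → Prop} {R : Set X}
    (hinc : ∀ y u v u' v', inc y u v → inc y u' v' → (u' = u ∧ v' = v) ∨ (u' = v ∧ v' = u))
    (hsymm : ∀ y u v, inc y u v → inc y v u)
    (hreach : ∀ x, ∃ r ∈ R, ReflTransGen (fun u v => ∃ y, inc y u v) r x) :
    ∃ (depth : X → ℕ) (par : {x // x ∉ R} → Y) (next : {x // x ∉ R} → X),
      (∀ x, inc (par x) x.1 (next x) ∧ depth (next x) < depth x.1) ∧ Function.Injective par := by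
  classical
  -- `reach n x` means that a walk of length `n` joins a root to `x`. The depth is the least such
  -- `n`, and the parent edge is the last edge of a shortest walk. An edge that is the parent of
  -- both its ends would make each end less deep than the other.
  let reach : ℕ → X → Prop := fun n => Nat.rec (motive := fun _ => X → Prop) (fun x => x ∈ R)
    (fun _ P x => ∃ y w, P w ∧ inc y w x) n
  have hex : ∀ x, ∃ n, reach n x := by
    intro x
    obtain ⟨r, hr, h⟩ := hreach x
    induction h with
    | refl => exact ⟨0, hr⟩
    | tail _ h ih =>
      obtain ⟨n, hn⟩ := ih
      obtain ⟨y, hy⟩ := h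
      exact ⟨n + 1, y, _, hn, hy⟩
  let depth : X → ℕ := fun x => Nat.find (hex x)
  have hpar : ∀ x : {x // x ∉ R}, ∃ y w, inc y x.1 w ∧ depth w < depth x.1 := by
    rintro ⟨x, hx⟩
    have h := Nat.find_spec (hex x)
    rcases hn : Nat.find (hex x) with _ | n
    · rw [hn] at h
      exact absurd h hx
    · rw [hn] at h
      obtain ⟨y, w, hw, hy⟩ := h
      refine ⟨y, w, hsymm _ _ _ hy, ?_⟩
      change Nat.find (hex w) < Nat.find (hex x)
      rw [hn]
      exact Nat.lt_succ_of_le (Nat.find_min' _ hw)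
  choose par next h1 h2 using hpar
  refine ⟨depth, par, next, fun x => ⟨h1 x, h2 x⟩, ?_⟩
  intro x x' h
  have e := h1 x'
  rw [← h] at e
  rcases hinc _ _ _ _ _ (h1 x) e with ⟨h3, -⟩ | ⟨h3, h4⟩
  · exact Subtype.ext h3.symm
  · have e1 := h2 x
    have e2 := h2 x'
    rw [h4] at e2
    rw [← h3] at e1
    exact absurd e1 e2.not_gt

/-- A section of `q` and its composite with `σ` together list every element exactly once. -/
lemma card_eq_two_mul_of_two_to_one {α β : Type*} (q : α → β) (σ : α → α)
    (hq : Function.Surjective q) (hσ : ∀ a, σ a ≠ a)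
    (h : ∀ a b, q a = q b ↔ b = a ∨ b = σ a) : Nat.card α = 2 * Nat.card β := by
  obtain ⟨s, hs⟩ := hq.hasRightInverse
  have hb : Function.Bijective
      (fun x : β × Bool => if x.2 then σ (s x.1) else s x.1) := by
    have hqs : ∀ x : β × Bool, q (if x.2 then σ (s x.1) else s x.1) = x.1 := by
      rintro ⟨b, _ | _⟩
      · exact hs b
      · exact ((h (s b) _).2 (Or.inr rfl)).symm.trans (hs b)
    constructor
    · intro x y hxy
      have h1 : x.1 = y.1 := by rw [← hqs x, ← hqs y]; exact congrArg q hxy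
      obtain ⟨b, i⟩ := x
      obtain ⟨b', j⟩ := y
      obtain rfl : b = b' := h1
      rcases i <;> rcases j
      · rfl
      · exact absurd hxy.symm (hσ _)
      · exact absurd hxy (hσ _)
      · rfl
    · intro a
      rcases (h (s (q a)) a).1 (hs _) with e | e
      · exact ⟨(q a, false), e.symm⟩
      · exact ⟨(q a, true), e.symm⟩
  rw [← Nat.card_congr (Equiv.ofBijective _ hb), Nat.card_prod, mul_comm]
  simp

/-- Pairs of a triangle `(t, i)` and one of its vertices `a`. -/
abbrev VertexFlag (τ : Type*) := {x : τ × Fin 4 × Fin 4 // x.2.1 ≠ x.2.2}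

lemma card_vertexFlag : Nat.card (VertexFlag τ) = 12 * Nat.card τ := by
  let e : VertexFlag τ ≃ τ × {z : Fin 4 × Fin 4 // z.1 ≠ z.2} :=
    { toFun := fun x => (x.1.1, ⟨x.1.2, x.2⟩)
      invFun := fun x => ⟨(x.1, x.2.1), x.2.2⟩
      left_inv := fun _ => rfl
      right_inv := fun _ => rfl }
  rw [Nat.card_congr e, Nat.card_prod, mul_comm, Nat.card_eq_fintype_card]
  rfl

/-! ### Counting triangles, half triangles and directed edges -/

namespace IsClosedTriangulation

variable (hT : T.IsClosedTriangulation)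

/-- The tetrahedron on the other side of a triangle. -/
noncomputable def nbr (t : τ) (i : Fin 4) : τ := (hT.exists_glue t i).choose

/-- The gluing map of a triangle. -/
noncomputable def gluePerm (t : τ) (i : Fin 4) : Equiv.Perm (Fin 4) :=
  (hT.exists_glue t i).choose_spec.choose

lemma glue_eq (t : τ) (i : Fin 4) : T.glue t i = some (hT.nbr t i, hT.gluePerm t i) :=
  (hT.exists_glue t i).choose_spec.choose_spec

lemma nbr_nbr (t : τ) (i : Fin 4) : hT.nbr (hT.nbr t i) (hT.gluePerm t i i) = t ∧
    hT.gluePerm (hT.nbr t i) (hT.gluePerm t i i) = (hT.gluePerm t i)⁻¹ := by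
  have := T.glue_symm _ _ _ _ (hT.glue_eq t i)
  rw [hT.glue_eq] at this
  exact Prod.mk.inj (Option.some.inj this)

lemma nbr_ne (t : τ) (i : Fin 4) : (hT.nbr t i, hT.gluePerm t i i) ≠ (t, i) :=
  T.glue_ne _ _ _ _ (hT.glue_eq t i)

/-- The number of triangles. -/
lemma card_triangles (hT : T.IsClosedTriangulation) :
    2 * Nat.card {f : T.Simplex // f.dim = 2} = 4 * Nat.card τ := by
  rw [← card_eq_two_mul_of_two_to_one (α := τ × Fin 4)
    (fun x => (⟨T.mkTriangle x.1 x.2, dim_mkTriangle _ _⟩ : {f : T.Simplex // f.dim = 2}))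
    (fun x => (hT.nbr x.1 x.2, hT.gluePerm x.1 x.2 x.2))]
  · rw [Nat.card_prod, mul_comm]; simp
  · rintro ⟨f, hf⟩
    obtain ⟨t, i, rfl⟩ := eq_mkTriangle_of_dim hf
    exact ⟨(t, i), rfl⟩
  · rintro ⟨t, i⟩
    exact hT.nbr_ne t i
  · rintro ⟨t, i⟩ ⟨u, j⟩
    rw [Subtype.mk.injEq, mkTriangle_eq_iff]
    constructor
    · rintro (⟨rfl, rfl⟩ | ⟨p, hp, rfl⟩)
      · exact Or.inl rfl
      · rw [hT.glue_eq] at hp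
        obtain ⟨rfl, rfl⟩ := Prod.mk.inj (Option.some.inj hp)
        exact Or.inr rfl
    · rintro (h | h)
      · obtain ⟨rfl, rfl⟩ := Prod.mk.inj h
        exact Or.inl ⟨rfl, rfl⟩
      · obtain ⟨rfl, rfl⟩ := Prod.mk.inj h
        exact Or.inr ⟨_, hT.glue_eq _ _, rfl⟩

/-- The vertex flag on the other side of a triangle. -/
noncomputable def crossVertex (x : VertexFlag τ) : VertexFlag τ :=
  ⟨(hT.nbr x.1.1 x.1.2.1, hT.gluePerm x.1.1 x.1.2.1 x.1.2.1, hT.gluePerm x.1.1 x.1.2.1 x.1.2.2),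
    fun h => x.2 ((hT.gluePerm x.1.1 x.1.2.1).injective h)⟩

lemma crossVertex_crossVertex (x : VertexFlag τ) : hT.crossVertex (hT.crossVertex x) = x := by
  obtain ⟨⟨t, i, a⟩, h⟩ := x
  obtain ⟨h1, h2⟩ := hT.nbr_nbr t i
  refine Subtype.ext (Prod.ext h1 (Prod.ext ?_ ?_)) <;>
  · change hT.gluePerm (hT.nbr t i) (hT.gluePerm t i i) _ = _
    rw [h2]; exact Equiv.symm_apply_apply _ _

lemma crossVertex_ne (x : VertexFlag τ) : hT.crossVertex x ≠ x := by
  intro h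
  apply hT.nbr_ne x.1.1 x.1.2.1
  exact Prod.ext (congrArg (fun z : VertexFlag τ => z.1.1) h)
    (congrArg (fun z : VertexFlag τ => z.1.2.1) h)

/-- The pair of a triangle of `T` and one of its vertices. -/
noncomputable def halfTriangle (x : VertexFlag τ) : Sym2 (VertexFlag τ) := s(x, hT.crossVertex x)

lemma halfTriangle_eq_iff {x y : VertexFlag τ} :
    hT.halfTriangle x = hT.halfTriangle y ↔ y = x ∨ y = hT.crossVertex x := by
  unfold halfTriangle
  rw [Sym2.eq_iff]
  constructor
  · rintro (⟨h, -⟩ | ⟨-, h⟩)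
    · exact Or.inl h.symm
    · exact Or.inr h.symm
  · rintro (rfl | rfl)
    · exact Or.inl ⟨rfl, rfl⟩
    · exact Or.inr ⟨(hT.crossVertex_crossVertex x).symm, rfl⟩

/-- Half triangles are the edges of the vertex links, each seen from two of the 12N vertex flags. -/
lemma card_halfTriangle :
    Nat.card (Set.range hT.halfTriangle) = 6 * Nat.card τ := by
  have := card_eq_two_mul_of_two_to_one (Set.rangeFactorization hT.halfTriangle) hT.crossVertex
    Set.rangeFactorization_surjective hT.crossVertex_ne (fun a b => by
      rw [← hT.halfTriangle_eq_iff]; exact Subtype.ext_iff)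
  rw [card_vertexFlag] at this
  omega

end IsClosedTriangulation

/-- The directed edges of a gluing. -/
def dirEdgeSetoid (T : Gluing τ) : Setoid (VertexFlag τ) where
  r x y := T.SameDirEdge x.1 y.1
  iseqv := ⟨fun _ => EqvGen.refl _, fun h => EqvGen.symm _ _ h,
    fun h k => EqvGen.trans _ _ _ h k⟩

/-- The directed edge of the glued complex from the vertex `a` to the vertex `b` of `t`. -/
def mkDirEdge (T : Gluing τ) (t : τ) (a b : Fin 4) (h : a ≠ b) : Quotient T.dirEdgeSetoid :=
  Quotient.mk _ ⟨(t, a, b), h⟩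

lemma mkDirEdge_eq_iff {t u : τ} {a b c d : Fin 4} {h : a ≠ b} {h' : c ≠ d} :
    T.mkDirEdge t a b h = T.mkDirEdge u c d h' ↔ T.SameDirEdge (t, a, b) (u, c, d) := by
  unfold mkDirEdge
  rw [Quotient.eq]
  rfl

lemma mkDirEdge_glue {t u : τ} {i a b : Fin 4} {p : Equiv.Perm (Fin 4)} (h : a ≠ b)
    (hg : T.glue t i = some (u, p)) (ha : i ≠ a) (hb : i ≠ b) :
    T.mkDirEdge t a b h = T.mkDirEdge u (p a) (p b) (fun e => h (p.injective e)) :=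
  mkDirEdge_eq_iff.2 (EqvGen.rel _ _ ⟨i, p, hg, ha, hb, rfl, rfl⟩)

/-- The origin of a directed edge. -/
def dirEdgeSource : Quotient T.dirEdgeSetoid → {x : T.Simplex // x.dim = 0} :=
  Quotient.lift (fun x => ⟨T.vert x.1.1 x.1.2.1, rfl⟩)
    fun _ _ h => Subtype.ext (SameDirEdge.vert_eq h).1

instance [Finite τ] : Finite (Quotient T.dirEdgeSetoid) :=
  Finite.of_surjective _ Quotient.mk_surjective

/-- Non-degeneracy says that reversal has no fixed point on directed edges. Taken by their origins,
directed edges are the vertices of the vertex links. -/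
lemma IsClosedTriangulation.card_dirEdges (hT : T.IsClosedTriangulation) :
    Nat.card (Quotient T.dirEdgeSetoid) = 2 * Nat.card {e : T.Simplex // e.dim = 1} := by
  refine card_eq_two_mul_of_two_to_one
    (Quotient.lift (fun x => (⟨T.mkEdge x.1.1 x.1.2.1 x.1.2.2, dim_mkEdge _ x.2⟩ :
      {e : T.Simplex // e.dim = 1})) fun _ _ h => Subtype.ext (SameDirEdge.mkEdge_eq h))
    (Quotient.map (fun x => ⟨(x.1.1, x.1.2.2, x.1.2.1), x.2.symm⟩)
      fun _ _ h => SameDirEdge.swap h) ?_ ?_ ?_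
  · rintro ⟨e, he⟩
    obtain ⟨t, a, b, hab, rfl⟩ := eq_mkEdge_of_dim he
    exact ⟨T.mkDirEdge t a b hab, rfl⟩
  · intro x
    induction x using Quotient.inductionOn with
    | h x =>
      intro h
      exact hT.nondegenerate x.1.1 x.1.2.1 x.1.2.2 x.2 (EqvGen.symm _ _ (Quotient.exact h))
  · intro x y
    induction x using Quotient.inductionOn with
    | h x =>
    induction y using Quotient.inductionOn with
    | h y =>
      constructor
      · intro h
        rcases sameDirEdge_of_mkEdge_eq (congrArg Subtype.val h) with h | h
        · exact Or.inl (Quotient.sound (EqvGen.symm _ _ h))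
        · exact Or.inr (Quotient.sound (EqvGen.symm _ _ h))
      · rintro (h | h)
        · rw [h]
        · have h : T.SameDirEdge y.1 (x.1.1, x.1.2.2, x.1.2.1) := Quotient.exact h
          refine Subtype.ext ?_
          change T.mkEdge x.1.1 x.1.2.1 x.1.2.2 = T.mkEdge y.1.1 y.1.2.1 y.1.2.2
          rw [h.mkEdge_eq, mkEdge_comm]

lemma reflTransGen_symm {α : Type*} {s : α → α → Prop} (hs : ∀ x y, s x y → s y x) {x y : α}
    (hxy : ReflTransGen s x y) : ReflTransGen s y x := by
  induction hxy with
  | refl => exact ReflTransGen.refl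
  | tail _ h ih => exact ReflTransGen.head (hs _ _ h) ih

lemma reflTransGen_of_eqvGen {α : Type*} {r s : α → α → Prop} (hs : ∀ x y, s x y → s y x)
    (h : ∀ x y, r x y → ReflTransGen s x y) {x y : α} (hxy : EqvGen r x y) :
    ReflTransGen s x y := by
  induction hxy with
  | rel x y h' => exact h _ _ h'
  | refl x => exact ReflTransGen.refl
  | symm x y _ ih => exact reflTransGen_symm hs ih
  | trans x y z _ _ ih1 ih2 => exact ih1.trans ih2

lemma card_compl_range {α β : Type*} [Finite β] {f : α → β} (hf : Function.Injective f) :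
    Nat.card {b // b ∉ Set.range f} + Nat.card α = Nat.card β := by
  have h := Set.ncard_add_ncard_compl (Set.range f)
  rw [← Nat.card_coe_set_eq, ← Nat.card_coe_set_eq, Nat.card_range_of_injective hf, add_comm] at h
  exact h

lemma fin4_other_two {i v j k j' k' : Fin 4} (hiv : i ≠ v) (hij : i ≠ j) (hik : i ≠ k)
    (hvj : v ≠ j) (hvk : v ≠ k) (hjk : j ≠ k) (hij' : i ≠ j') (hik' : i ≠ k') (hvj' : v ≠ j')
    (hvk' : v ≠ k') (hjk' : j' ≠ k') : (j' = j ∧ k' = k) ∨ (j' = k ∧ k' = j) := by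
  omega

lemma fin4_exists_two {i v : Fin 4} (h : i ≠ v) :
    ∃ j k, v ≠ j ∧ v ≠ k ∧ i ≠ j ∧ i ≠ k ∧ j ≠ k := by
  revert i v; decide

lemma fin4_exists_other (v j k : Fin 4) : ∃ i : Fin 4, i ≠ v ∧ i ≠ j ∧ i ≠ k := by
  revert v j k; decide

/-! ### Tree and cotree in the vertex links -/

namespace IsClosedTriangulation

variable (hT : T.IsClosedTriangulation)

/-- The corner of a vertex flag. -/
def corner (x : VertexFlag τ) : τ × Fin 4 := (x.1.1, x.1.2.2)

/-- The corners on the two sides of a half triangle. -/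
def CornerInc (y : Sym2 (VertexFlag τ)) (c d : τ × Fin 4) : Prop :=
  ∃ x, y = hT.halfTriangle x ∧ c = corner x ∧ d = corner (hT.crossVertex x)

/-- The two directed edges at a half triangle. -/
def EndInc (y : Sym2 (VertexFlag τ)) (d d' : Quotient T.dirEdgeSetoid) : Prop :=
  ∃ (t : τ) (i v j k : Fin 4) (hiv : i ≠ v) (hvj : v ≠ j) (hvk : v ≠ k), i ≠ j ∧ i ≠ k ∧ j ≠ k ∧
    y = hT.halfTriangle ⟨(t, i, v), hiv⟩ ∧ d = T.mkDirEdge t v j hvj ∧ d' = T.mkDirEdge t v k hvk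

lemma cornerInc_symm {y : Sym2 (VertexFlag τ)} {c d : τ × Fin 4} (h : hT.CornerInc y c d) :
    hT.CornerInc y d c := by
  obtain ⟨x, rfl, rfl, rfl⟩ := h
  exact ⟨hT.crossVertex x, hT.halfTriangle_eq_iff.2 (Or.inr rfl), rfl,
    by rw [hT.crossVertex_crossVertex]⟩

lemma cornerInc_unique {y : Sym2 (VertexFlag τ)} {c d c' d' : τ × Fin 4}
    (h : hT.CornerInc y c d) (h' : hT.CornerInc y c' d') :
    (c' = c ∧ d' = d) ∨ (c' = d ∧ d' = c) := by
  obtain ⟨x, rfl, rfl, rfl⟩ := h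
  obtain ⟨x', e, rfl, rfl⟩ := h'
  rcases hT.halfTriangle_eq_iff.1 e with rfl | rfl
  · exact Or.inl ⟨rfl, rfl⟩
  · exact Or.inr ⟨rfl, by rw [hT.crossVertex_crossVertex]⟩

lemma endInc_symm {y : Sym2 (VertexFlag τ)} {d d' : Quotient T.dirEdgeSetoid}
    (h : hT.EndInc y d d') : hT.EndInc y d' d := by
  obtain ⟨t, i, v, j, k, hiv, hvj, hvk, hij, hik, hjk, e, e1, e2⟩ := h
  exact ⟨t, i, v, k, j, hiv, hvk, hvj, hik, hij, hjk.symm, e, e2, e1⟩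

/-- In `t` only two vertices differ from both `i` and `v`; crossing the triangle carries them to
their counterparts without changing the directed edges. -/
lemma endInc_unique {y : Sym2 (VertexFlag τ)} {c d c' d' : Quotient T.dirEdgeSetoid}
    (h : hT.EndInc y c d) (h' : hT.EndInc y c' d') :
    (c' = c ∧ d' = d) ∨ (c' = d ∧ d' = c) := by
  have same : ∀ (t : τ) (i v : Fin 4) (hiv : i ≠ v) (j k j' k' : Fin 4) (hvj : v ≠ j) (hvk : v ≠ k)
      (hvj' : v ≠ j') (hvk' : v ≠ k'), i ≠ j → i ≠ k → j ≠ k → i ≠ j' → i ≠ k' → j' ≠ k' →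
      (T.mkDirEdge t v j' hvj' = T.mkDirEdge t v j hvj ∧
        T.mkDirEdge t v k' hvk' = T.mkDirEdge t v k hvk) ∨
      (T.mkDirEdge t v j' hvj' = T.mkDirEdge t v k hvk ∧
        T.mkDirEdge t v k' hvk' = T.mkDirEdge t v j hvj) := by
    intro t i v hiv j k j' k' hvj hvk hvj' hvk' hij hik hjk hij' hik' hjk'
    rcases fin4_other_two hiv hij hik hvj hvk hjk hij' hik' hvj' hvk' hjk' with
      ⟨rfl, rfl⟩ | ⟨rfl, rfl⟩
    · exact Or.inl ⟨rfl, rfl⟩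
    · exact Or.inr ⟨rfl, rfl⟩
  obtain ⟨t, i, v, j, k, hiv, hvj, hvk, hij, hik, hjk, rfl, rfl, rfl⟩ := h
  obtain ⟨t', i', v', j', k', hiv', hvj', hvk', hij', hik', hjk', e, rfl, rfl⟩ := h'
  rcases hT.halfTriangle_eq_iff.1 e with e | e
  · cases e
    exact same t i v hiv j k j' k' hvj hvk hvj' hvk' hij hik hjk hij' hik' hjk'
  · have e' := congrArg Subtype.val e
    simp only [crossVertex, Prod.mk.injEq] at e'
    obtain ⟨rfl, rfl, rfl⟩ := e'
    have hg := hT.glue_eq t i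
    have inj := (hT.gluePerm t i).injective
    rw [mkDirEdge_glue hvj hg hiv hij, mkDirEdge_glue hvk hg hiv hik]
    exact same _ _ _ hiv' _ _ j' k' _ _ hvj' hvk' (fun h => hij (inj h)) (fun h => hik (inj h))
      (fun h => hjk (inj h)) hij' hik' hjk'

lemma exists_cornerInc {c d : τ × Fin 4} (h : T.CornerIdent c d) : ∃ y, hT.CornerInc y c d := by
  obtain ⟨i, p, hg, hi, h⟩ := h
  have hg' := hT.glue_eq c.1 i
  rw [hg] at hg'
  obtain ⟨h1, h2⟩ := Prod.mk.inj (Option.some.inj hg')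
  refine ⟨_, ⟨(c.1, i, c.2), hi⟩, rfl, rfl, ?_⟩
  exact Prod.ext h1 (h.trans (by rw [h2]; rfl))

/-- The sum of the Euler characteristics of the vertex links is at most twice the number of
vertices; in other words, the Euler characteristic of a triangulation is nonnegative. -/
theorem card_edges_le [Finite τ] (hT : T.IsClosedTriangulation) :
    Nat.card {e : T.Simplex // e.dim = 1} ≤
      Nat.card {v : T.Simplex // v.dim = 0} + Nat.card τ := by
  classical
  -- A spanning forest of the dual graphs of the vertex links.
  have hroot : ∀ v : {v : T.Simplex // v.dim = 0}, ∃ c : τ × Fin 4, T.vert c.1 c.2 = v.1 := by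
    rintro ⟨v, hv⟩
    obtain ⟨t, a, rfl⟩ := eq_vert_of_dim hv
    exact ⟨(t, a), rfl⟩
  choose root hroot using hroot
  have root_inj : Function.Injective root := fun v w h => Subtype.ext (by
    rw [← hroot v, ← hroot w, h])
  obtain ⟨depth, par, next, hpar, par_inj⟩ :=
    exists_rooted_forest (inc := hT.CornerInc) (R := Set.range root)
      (fun _ _ _ _ _ h h' => hT.cornerInc_unique h h') (fun _ _ _ h => hT.cornerInc_symm h)
      (fun c => ⟨_, ⟨⟨T.vert c.1 c.2, rfl⟩, rfl⟩, reflTransGen_of_eqvGen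
        (fun _ _ ⟨y, h⟩ => ⟨y, hT.cornerInc_symm h⟩)
        (fun _ _ h => ReflTransGen.single (hT.exists_cornerInc h))
        (cornerIdent_of_vert_eq (hroot ⟨T.vert c.1 c.2, rfl⟩))⟩)
  -- The half triangles outside the forest connect the vertices of the links.
  let inc : Sym2 (VertexFlag τ) → Quotient T.dirEdgeSetoid → Quotient T.dirEdgeSetoid → Prop :=
    fun y d d' => (∀ c, par c ≠ y) ∧ hT.EndInc y d d'
  let conn : Quotient T.dirEdgeSetoid → Quotient T.dirEdgeSetoid → Prop :=
    ReflTransGen fun d d' => ∃ y, inc y d d'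
  have inc_symm : ∀ d d', (∃ y, inc y d d') → ∃ y, inc y d' d :=
    fun _ _ ⟨y, h1, h2⟩ => ⟨y, h1, hT.endInc_symm h2⟩
  have conn_symm : ∀ d d', conn d d' → conn d' d := fun _ _ h => reflTransGen_symm inc_symm h
  obtain ⟨B, hB⟩ := (Set.finite_range depth).bddAbove
  -- Removing the dual forest keeps each link connected: a parent side of a corner is bypassed along
  -- the other two sides of that corner. The induction treats the deepest corners first, and `n = 0`
  -- is void.
  have hconn_par : ∀ n c, B < n + depth c.1 → ∀ d d', hT.EndInc (par c) d d' → conn d d' := by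
    intro n
    induction n with
    | zero =>
      intro c hc
      have := hB (Set.mem_range_self c.1)
      omega
    | succ n ih =>
      intro c hc d d' hd
      obtain ⟨⟨x, e, hcx, hnx⟩, hlt⟩ := hpar c
      obtain ⟨⟨t, i, v⟩, hiv⟩ := x
      have hcx : c.1 = (t, v) := hcx
      obtain ⟨j, k, hvj, hvk, hij, hik, hjk⟩ := fin4_exists_two hiv
      have other : ∀ j k (hvj : v ≠ j) (hvk : v ≠ k), i ≠ j → i ≠ k → j ≠ k →
          conn (T.mkDirEdge t v i (Ne.symm hiv)) (T.mkDirEdge t v k hvk) := by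
        intro j k hvj hvk hij hik hjk
        have hend : hT.EndInc (hT.halfTriangle ⟨(t, j, v), Ne.symm hvj⟩)
            (T.mkDirEdge t v i (Ne.symm hiv)) (T.mkDirEdge t v k hvk) :=
          ⟨t, j, v, i, k, Ne.symm hvj, Ne.symm hiv, hvk, hij.symm, hjk, hik, rfl, rfl, rfl⟩
        by_cases h : ∀ c', par c' ≠ hT.halfTriangle ⟨(t, j, v), Ne.symm hvj⟩
        · exact ReflTransGen.single ⟨_, h, hend⟩
        · push Not at h
          obtain ⟨c', hc'⟩ := h
          rw [← hc'] at hend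
          refine ih c' ?_ _ _ hend
          have h2 := hpar c'
          have h5 : hT.CornerInc (par c') (t, v)
            (corner (hT.crossVertex ⟨(t, j, v), Ne.symm hvj⟩)) := ⟨_, hc', rfl, rfl⟩
          rcases hT.cornerInc_unique h5 h2.1 with
            ⟨h3, -⟩ | ⟨-, h3⟩
          -- Two different sides of one corner would be the same half triangle, so that the corner
          -- would be its own parent, against the decrease of depth. In the other case `c'` is a
          -- child of `c`, hence deeper.
          · obtain rfl : c' = c := Subtype.ext (h3.trans hcx.symm)
            rw [e] at hc'
            rcases hT.halfTriangle_eq_iff.1 hc' with h4 | h4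
            · exact absurd (congrArg (fun z : VertexFlag τ => z.1.2.1) h4).symm hij
            · rw [hnx, ← h4, hcx] at hlt
              exact absurd hlt (lt_irrefl _)
          · have h4 : next c' = c.1 := h3.trans hcx.symm
            have := h2.2
            rw [h4] at this
            omega
      have main : conn (T.mkDirEdge t v j hvj) (T.mkDirEdge t v k hvk) :=
        (conn_symm _ _ (other k j hvk hvj hik hij hjk.symm)).trans (other j k hvj hvk hij hik hjk)
      rw [e] at hd
      rcases hT.endInc_unique ⟨t, i, v, j, k, hiv, hvj, hvk, hij, hik, hjk, rfl, rfl, rfl⟩ hd with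
        ⟨rfl, rfl⟩ | ⟨rfl, rfl⟩
      · exact main
      · exact conn_symm _ _ main
  have hconn : ∀ y d d', hT.EndInc y d d' → conn d d' := by
    intro y d d' h
    by_cases hy : ∀ c, par c ≠ y
    · exact ReflTransGen.single ⟨y, hy, h⟩
    · push Not at hy
      obtain ⟨c, rfl⟩ := hy
      exact hconn_par (B + 1) c (by omega) d d' h
  have hstar : ∀ t v j k (hj : v ≠ j) (hk : v ≠ k),
      conn (T.mkDirEdge t v j hj) (T.mkDirEdge t v k hk) := by
    intro t v j k hj hk
    by_cases hjk : j = k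
    · subst hjk; exact ReflTransGen.refl
    · obtain ⟨i, hiv, hij, hik⟩ := fin4_exists_other v j k
      exact hconn _ _ _ ⟨t, i, v, j, k, hiv, hj, hk, hij, hik, hjk, rfl, rfl, rfl⟩
  have hcorner : ∀ c c', EqvGen T.CornerIdent c c' → ∀ j j' (h : c.2 ≠ j) (h' : c'.2 ≠ j'),
      conn (T.mkDirEdge c.1 c.2 j h) (T.mkDirEdge c'.1 c'.2 j' h') := by
    intro c c' hcc
    induction hcc with
    | rel c c' h =>
      intro j j' hj hj'
      obtain ⟨t, v⟩ := c
      obtain ⟨u, w⟩ := c'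
      obtain ⟨i, p, hg, hi, rfl⟩ := h
      obtain ⟨m, hmv, hmi, -⟩ := fin4_exists_other v i i
      refine (hstar t v j m hj hmv.symm).trans ?_
      rw [mkDirEdge_glue hmv.symm hg hi hmi.symm]
      exact hstar _ _ _ _ _ _
    | refl c => intro j j' h h'; exact hstar _ _ _ _ _ _
    | symm c c' _ ih => intro j j' h h'; exact conn_symm _ _ (ih j' j h' h)
    | trans c c' c'' _ _ ih1 ih2 =>
      intro j j' h h'
      obtain ⟨m, hm, -⟩ := fin4_exists_other c'.2 c'.2 c'.2
      exact (ih1 j m h hm.symm).trans (ih2 m j' hm.symm h')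
  -- A spanning forest of the links whose edges are the remaining half triangles.
  have hj : ∀ v, ∃ j, (root v).2 ≠ j := fun v => by
    obtain ⟨m, hm, -⟩ := fin4_exists_other (root v).2 (root v).2 (root v).2
    exact ⟨m, hm.symm⟩
  choose j hj using hj
  let root' : {v : T.Simplex // v.dim = 0} → Quotient T.dirEdgeSetoid := fun v =>
    T.mkDirEdge (root v).1 (root v).2 (j v) (hj v)
  have root'_inj : Function.Injective root' := by
    intro v w h
    have h' : (⟨T.vert (root v).1 (root v).2, rfl⟩ : {v : T.Simplex // v.dim = 0}) =
      ⟨T.vert (root w).1 (root w).2, rfl⟩ := congrArg dirEdgeSource h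
    have := congrArg Subtype.val h'
    simp only [hroot] at this
    exact Subtype.ext this
  obtain ⟨depth', par', next', hpar', par'_inj⟩ :=
    exists_rooted_forest (inc := inc) (R := Set.range root')
      (fun _ _ _ _ _ h h' => hT.endInc_unique h.2 h'.2)
      (fun _ _ _ h => ⟨h.1, hT.endInc_symm h.2⟩)
      (fun d => by
        induction d using Quotient.inductionOn with
        | h x =>
          refine ⟨_, ⟨⟨T.vert x.1.1 x.1.2.1, rfl⟩, rfl⟩, ?_⟩
          exact hcorner _ (x.1.1, x.1.2.1) (cornerIdent_of_vert_eq (hroot _)) _ _ _ x.2)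
  -- The dual forest uses 4N − v half triangles, and the second forest uses 2e − v others. There are
  -- 6N in all, whence e ≤ v + N.
  have hsum : Nat.card ({c // c ∉ Set.range root} ⊕ {d // d ∉ Set.range root'}) ≤
      Nat.card (Set.range hT.halfTriangle) := by
    refine Nat.card_le_card_of_injective (Sum.elim
      (fun c => ⟨par c, by obtain ⟨x, e, -⟩ := (hpar c).1; exact ⟨x, e.symm⟩⟩)
      (fun d => ⟨par' d, by
        obtain ⟨t, i, v, j, k, hiv, hvj, hvk, hij, hik, hjk, e, -⟩ := (hpar' d).1.2
        exact ⟨_, e.symm⟩⟩)) ?_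
    rintro (c | d) (c' | d') h
    · rw [par_inj (congrArg Subtype.val h)]
    · exact absurd (congrArg Subtype.val h) ((hpar' d').1.1 c)
    · exact absurd (congrArg Subtype.val h).symm ((hpar' d).1.1 c')
    · rw [par'_inj (congrArg Subtype.val h)]
  have h1 := card_compl_range root_inj
  have h2 := card_compl_range root'_inj
  rw [Nat.card_prod, Nat.card_fin] at h1
  rw [hT.card_dirEdges] at h2
  rw [Nat.card_sum, hT.card_halfTriangle] at hsum
  omega

end IsClosedTriangulation

lemma card_ne_add_one {α : Type*} [Finite α] (a : α) :
    Nat.card {x // x ∉ ({a} : Set α)} + 1 = Nat.card α := by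
  have h := Set.ncard_add_ncard_compl ({a} : Set α)
  rw [Set.ncard_singleton, ← Nat.card_coe_set_eq, add_comm] at h
  exact h

/-! ### From a local construction to a gradient -/

namespace LocalConstruction

variable (c : T.LocalConstruction)

lemma base_glue {t : τ} {i : Fin 4} (h : T.mkTriangle t i ∈ c.baseTriangles) :
    c.base.glue t i = T.glue t i := by
  rw [c.base_eq_restrict, restrict_glue_of_mem h]

/-- The two tetrahedra at a triangle of the base tree. -/
def DualInc (f : T.Simplex) (t u : τ) : Prop :=
  ∃ i p, f = T.mkTriangle t i ∧ c.base.glue t i = some (u, p)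

lemma DualInc.symm {c : T.LocalConstruction} {f : T.Simplex} {t u : τ} (h : c.DualInc f t u) :
    c.DualInc f u t := by
  obtain ⟨i, p, rfl, h⟩ := h
  exact ⟨p i, p⁻¹, mkTriangle_glue (c.glue_of_stage h), c.base.glue_symm _ _ _ _ h⟩

lemma DualInc.unique {c : T.LocalConstruction} {f : T.Simplex} {t u t' u' : τ}
    (h : c.DualInc f t u) (h' : c.DualInc f t' u') : (t' = t ∧ u' = u) ∨ (t' = u ∧ u' = t) := by
  obtain ⟨i, p, rfl, h⟩ := h
  obtain ⟨i', p', e, h'⟩ := h'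
  rcases mkTriangle_eq_iff.1 e with ⟨rfl, rfl⟩ | ⟨q, hq, rfl⟩
  · rw [h] at h'
    exact Or.inl ⟨rfl, (Prod.mk.inj (Option.some.inj h')).1.symm⟩
  · rw [c.glue_of_stage h] at hq
    obtain ⟨rfl, rfl⟩ := Prod.mk.inj (Option.some.inj hq)
    rw [c.base.glue_symm _ _ _ _ h] at h'
    exact Or.inr ⟨rfl, (Prod.mk.inj (Option.some.inj h')).1.symm⟩

lemma DualInc.mem {c : T.LocalConstruction} {f : T.Simplex} {t u : τ} (h : c.DualInc f t u) :
    f ∈ c.baseTriangles := by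
  obtain ⟨i, p, rfl, h⟩ := h
  exact ⟨t, i, by rw [h]; simp, rfl⟩

/-- Without loops and multiple edges, the glued triangles inject into the edges of the simple dual
graph, a tree. -/
lemma card_baseTriangles_le [Finite τ] : Nat.card c.baseTriangles + 1 ≤ Nat.card τ := by
  have hinc : ∀ f : c.baseTriangles, ∃ t u, c.DualInc f.1 t u := by
    rintro ⟨f, t, i, h, rfl⟩
    obtain ⟨⟨u, p⟩, h⟩ := Option.ne_none_iff_exists'.1 h
    exact ⟨t, u, i, p, rfl, h⟩
  choose t u h using hinc
  have hadj : ∀ f, c.base.dualGraph.Adj (t f) (u f) := by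
    intro f
    obtain ⟨i, p, -, hg⟩ := h f
    refine ⟨fun e => ?_, i, p, hg⟩
    change t f = u f at e
    rw [← e] at hg
    exact c.base_tree.no_loop _ _ _ hg
  have hle : Nat.card c.baseTriangles ≤ Nat.card c.base.dualGraph.edgeSet := by
    refine Nat.card_le_card_of_injective
      (fun f => (⟨s(t f, u f), hadj f⟩ : c.base.dualGraph.edgeSet)) fun f g e => ?_
    have key : ∀ x y, c.DualInc f.1 x y → c.DualInc g.1 x y → f = g := by
      rintro x y ⟨i, p, e1, h1⟩ ⟨j, q, e2, h2⟩
      refine Subtype.ext ?_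
      rw [e1, e2, c.base_tree.no_multi _ _ _ _ _ _ h1 h2]
    have e' : s(t f, u f) = s(t g, u g) := congrArg Subtype.val e
    rcases Sym2.eq_iff.1 e' with ⟨e1, e2⟩ | ⟨e1, e2⟩
    · exact key _ _ (h f) (by rw [e1, e2]; exact h g)
    · exact key _ _ (h f) (by rw [e1, e2]; exact (h g).symm)
  have := (SimpleGraph.isTree_iff_connected_and_card.1 c.base_tree.isTree).2
  change Nat.card c.base.dualGraph.edgeSet + 1 = _ at this
  omega

/-- The base tree of a local construction, rooted at some tetrahedron. -/
lemma exists_rooted_base [Finite τ] :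
    ∃ (r : τ) (depth : τ → ℕ) (par : {t // t ∉ ({r} : Set τ)} → T.Simplex)
      (next : {t // t ∉ ({r} : Set τ)} → τ),
      (∀ t, c.DualInc (par t) t.1 (next t) ∧ depth (next t) < depth t.1) ∧
        Function.Injective par ∧ Set.range par = c.baseTriangles := by
  have hconn : c.base.dualGraph.Connected := c.base_tree.isTree.connected
  obtain ⟨r⟩ := hconn.nonempty
  obtain ⟨depth, par, next, hpar, hinj⟩ := exists_rooted_forest (inc := c.DualInc) (R := {r})
    (fun _ _ _ _ _ h h' => h.unique h') (fun _ _ _ h => h.symm) (fun t => by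
      refine ⟨r, rfl, ?_⟩
      refine ReflTransGen.mono ?_ _ _
        ((SimpleGraph.reachable_iff_reflTransGen r t).1 (hconn.preconnected r t))
      rintro t u ⟨-, i, p, h⟩
      exact ⟨_, i, p, rfl, h⟩)
  -- The parent triangles are N − 1 distinct triangles of the tree, which has no more than that.
  refine ⟨r, depth, par, next, hpar, hinj, Set.eq_of_subset_of_ncard_le ?_ ?_ (Set.toFinite _)⟩
  · rintro _ ⟨t, rfl⟩
    exact (hpar t).1.mem
  · rw [← Nat.card_coe_set_eq, ← Nat.card_coe_set_eq, Nat.card_range_of_injective hinj]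
    have := card_ne_add_one r
    have := c.card_baseTriangles_le
    omega

/-- The number of edges of the critical tree. -/
lemma card_criticalTree_le [Finite τ] (hT : T.IsClosedTriangulation) :
    Nat.card c.criticalTree + 1 ≤ Nat.card {v : T.Simplex // v.dim = 0} := by
  classical
  -- With n steps, 2N ≤ (N − 1) + n gives n ≥ N + 1. By `h2` and `card_edges_le`, the critical tree
  -- has at most e − n ≤ (v + N) − (N + 1) = v − 1 edges.
  have h1 : Nat.card {f : T.Simplex // f.dim = 2} ≤
      Nat.card (c.baseTriangles ⊕ Fin c.numSteps) := by
    refine Nat.card_le_card_of_injective (fun f => if h : f.1 ∈ c.baseTriangles then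
      Sum.inl ⟨f.1, h⟩ else Sum.inr ((c.triangle_cases hT f.2).resolve_left h).choose) ?_
    intro f g hfg
    have spec := fun (f : {f : T.Simplex // f.dim = 2}) (h : f.1 ∉ c.baseTriangles) =>
      ((c.triangle_cases hT f.2).resolve_left h).choose_spec
    simp only at hfg
    split_ifs at hfg with hf hg hg
    · have h := Sum.inl.inj hfg
      exact Subtype.ext (Subtype.mk.inj h)
    · refine Subtype.ext ?_
      rw [spec f hf, spec g hg, Sum.inr.inj hfg]
  have h2 : Nat.card (c.criticalTree ⊕ Fin c.numSteps) ≤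
      Nat.card {e : T.Simplex // e.dim = 1} := by
    refine Nat.card_le_card_of_injective (Sum.elim (fun e => ⟨e.1, e.2.1⟩)
      (fun s => ⟨c.chosenEdge s, c.dim_chosenEdge s⟩)) ?_
    rintro (e | s) (e' | s') h
    · exact congrArg Sum.inl (Subtype.ext (Subtype.mk.inj h))
    · exact absurd (congrArg Subtype.val h).symm (e.2.2 s')
    · exact absurd (congrArg Subtype.val h) (e'.2.2 s)
    · rw [c.chosenEdge_injective (congrArg Subtype.val h)]
  rw [Nat.card_sum, Nat.card_fin] at h1 h2
  have h3 := hT.card_triangles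
  have h4 := hT.card_edges_le
  have h5 := c.card_baseTriangles_le
  omega

/-- The two ends of an edge of the critical tree. -/
def TreeInc (e : T.Simplex) (v w : {v : T.Simplex // v.dim = 0}) : Prop :=
  e ∈ c.criticalTree ∧ ∃ t a b, a ≠ b ∧ e = T.mkEdge t a b ∧ v.1 = T.vert t a ∧ w.1 = T.vert t b

lemma TreeInc.symm {c : T.LocalConstruction} {e : T.Simplex} {v w : {v : T.Simplex // v.dim = 0}}
    (h : c.TreeInc e v w) : c.TreeInc e w v := by
  obtain ⟨hm, t, a, b, hab, he, hv, hw⟩ := h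
  exact ⟨hm, t, b, a, hab.symm, he.trans (mkEdge_comm _ _ _), hw, hv⟩

lemma TreeInc.ends {c : T.LocalConstruction} {e : T.Simplex} {v w : {v : T.Simplex // v.dim = 0}}
    (h : c.TreeInc e v w) {t : τ} {a b : Fin 4} (he : e = T.mkEdge t a b) :
    (T.vert t a = v.1 ∧ T.vert t b = w.1) ∨ (T.vert t a = w.1 ∧ T.vert t b = v.1) := by
  obtain ⟨hm, t', a', b', hab, he', hv, hw⟩ := h
  rw [hv, hw]
  exact mkEdge_verts (he.symm.trans he')

lemma TreeInc.unique {c : T.LocalConstruction} {e : T.Simplex}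
    {v w v' w' : {v : T.Simplex // v.dim = 0}}
    (h : c.TreeInc e v w) (h' : c.TreeInc e v' w') : (v' = v ∧ w' = w) ∨ (v' = w ∧ w' = v) := by
  obtain ⟨hm', t', a', b', hab', he', hv', hw'⟩ := h'
  rcases h.ends he' with ⟨h1, h2⟩ | ⟨h1, h2⟩
  · exact Or.inl ⟨Subtype.ext (hv'.trans h1), Subtype.ext (hw'.trans h2)⟩
  · exact Or.inr ⟨Subtype.ext (hv'.trans h1), Subtype.ext (hw'.trans h2)⟩

/-- The critical tree spans the vertices. -/
lemma criticalTree_connected [Finite τ] (hT : T.IsClosedTriangulation)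
    (v w : {v : T.Simplex // v.dim = 0}) :
    ReflTransGen (fun v w => ∃ e, c.TreeInc e v w) v w := by
  let conn : T.Simplex → T.Simplex → Prop := fun x y =>
    ∀ (hx : x.dim = 0) (hy : y.dim = 0),
      ReflTransGen (fun v w => ∃ e, c.TreeInc e v w) ⟨x, hx⟩ ⟨y, hy⟩
  have conn_symm : ∀ x y, conn x y → conn y x := fun x y h hy hx =>
    reflTransGen_symm (fun _ _ ⟨e, h⟩ => ⟨e, h.symm⟩) (h hx hy)
  have conn_refl : ∀ x, conn x x := fun x _ _ => ReflTransGen.refl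
  have conn_trans : ∀ x t a y, conn x (T.vert t a) → conn (T.vert t a) y → conn x y :=
    fun x t a y h h' hx hy => (h hx rfl).trans (h' rfl hy)
  have hcases : ∀ t a b, a ≠ b → (∀ s, c.chosenEdge s = T.mkEdge t a b →
      conn (T.vert t a) (T.vert t b)) → conn (T.vert t a) (T.vert t b) := by
    intro t a b hab h
    by_cases hs : ∃ s, c.chosenEdge s = T.mkEdge t a b
    · obtain ⟨s, hs⟩ := hs
      exact h s hs
    · push Not at hs
      exact fun _ _ => ReflTransGen.single
        ⟨_, ⟨dim_mkEdge t hab, hs⟩, t, a, b, hab, rfl, rfl, rfl⟩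
  -- Downward induction on the step: the ends of a chosen edge are joined through the third vertex
  -- of the triangle glued at that step, whose other two edges are critical or chosen strictly
  -- later.
  have hchosen : ∀ n : ℕ, ∀ s : Fin c.numSteps, c.numSteps ≤ s + n →
      ∀ t a b, c.chosenEdge s = T.mkEdge t a b → conn (T.vert t a) (T.vert t b) := by
    intro n
    induction n with
    | zero => intro s hs; exact absurd s.2 (by omega)
    | succ n ih =>
      intro s hs t a b he
      have hm := c.allowed s
      have later : ∀ x y, x ≠ y → x ≠ (c.move s).facet → y ≠ (c.move s).facet →
          ({x, y} : Finset (Fin 4)) ≠ {(c.move s).a, (c.move s).b} →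
          conn (T.vert (c.move s).tet₁ x) (T.vert (c.move s).tet₁ y) := by
        intro x y hxy hx hy hne
        refine hcases _ _ _ hxy fun r hr => ?_
        have hle := c.le_of_chosenEdge hx hy hr.symm (r := s) rfl
        rcases hle.lt_or_eq with h | rfl
        · exact ih r (by have : (s : ℕ) < r := h; omega) _ _ _ hr
        · exact absurd (c.pair_eq_of_chosenEdge hx hy hm.a_ne_facet hm.b_ne_facet hr.symm rfl rfl)
            hne
      obtain ⟨k, hkf, hka, hkb⟩ :=
        fin4_exists_other (c.move s).facet (c.move s).a (c.move s).b
      have main : conn (T.vert (c.move s).tet₁ (c.move s).a)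
          (T.vert (c.move s).tet₁ (c.move s).b) := by
        refine conn_trans _ (c.move s).tet₁ k _ (later _ _ hka.symm hm.a_ne_facet hkf ?_)
          (later _ _ hkb hkf hm.b_ne_facet ?_)
        · intro h
          rcases pair_eq_pair h with ⟨-, h⟩ | ⟨h, -⟩
          · exact hkb h.symm
          · exact hka h.symm
        · intro h
          rcases pair_eq_pair h with ⟨h, -⟩ | ⟨h, -⟩
          · exact hka h.symm
          · exact hm.a_ne_b h
      rcases mkEdge_verts he with ⟨h1, h2⟩ | ⟨h1, h2⟩
      · rwa [← h1, ← h2]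
      · rw [← h1, ← h2]; exact conn_symm _ _ main
  have htet : ∀ t a b, conn (T.vert t a) (T.vert t b) := by
    intro t a b
    by_cases hab : a = b
    · rw [hab]; exact conn_refl _
    · exact hcases t a b hab fun s hs => hchosen c.numSteps s (by omega) t a b hs
  have hall : ∀ t u, ReflTransGen T.dualGraph.Adj t u → ∀ a b,
      conn (T.vert t a) (T.vert u b) := by
    intro t u h
    induction h with
    | refl => exact htet t
    | tail _ h ih =>
      intro a b
      obtain ⟨-, i, p, hg⟩ := h
      obtain ⟨k, hk, -⟩ := fin4_exists_other i i i
      refine conn_trans _ _ k _ (ih a k) ?_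
      rw [vert_glue hg hk.symm]
      exact htet _ _ _
  obtain ⟨v, hv⟩ := v
  obtain ⟨w, hw⟩ := w
  obtain ⟨t, a, rfl⟩ := eq_vert_of_dim hv
  obtain ⟨u, b, rfl⟩ := eq_vert_of_dim hw
  exact hall t u ((SimpleGraph.reachable_iff_reflTransGen t u).1
    (hT.connected.preconnected t u)) a b hv hw

/-- The critical tree of a local construction, rooted at some vertex. -/
lemma exists_rooted_criticalTree [Finite τ] (hT : T.IsClosedTriangulation) :
    ∃ (r : {v : T.Simplex // v.dim = 0}) (depth : {v : T.Simplex // v.dim = 0} → ℕ)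
      (par : {v // v ∉ ({r} : Set {v : T.Simplex // v.dim = 0})} → T.Simplex)
      (next : {v // v ∉ ({r} : Set {v : T.Simplex // v.dim = 0})} →
        {v : T.Simplex // v.dim = 0}),
      (∀ v, c.TreeInc (par v) v.1 (next v) ∧ depth (next v) < depth v.1) ∧
        Function.Injective par ∧ Set.range par = c.criticalTree := by
  obtain ⟨t₀⟩ := hT.connected.nonempty
  obtain ⟨depth, par, next, hpar, hinj⟩ := exists_rooted_forest (inc := c.TreeInc)
    (R := {⟨T.vert t₀ 0, rfl⟩})
    (fun _ _ _ _ _ h h' => h.unique h') (fun _ _ _ h => h.symm)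
    (fun v => ⟨_, rfl, c.criticalTree_connected hT _ v⟩)
  -- The parent edges are v − 1 distinct critical edges, and by the Euler characteristic bound there
  -- are no more.
  refine ⟨_, depth, par, next, hpar, hinj, Set.eq_of_subset_of_ncard_le ?_ ?_ (Set.toFinite _)⟩
  · rintro _ ⟨t, rfl⟩
    exact (hpar t).1.1
  · rw [← Nat.card_coe_set_eq, ← Nat.card_coe_set_eq, Nat.card_range_of_injective hinj]
    have := card_ne_add_one (⟨T.vert t₀ 0, rfl⟩ : {v : T.Simplex // v.dim = 0})
    have := c.card_criticalTree_le hT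
    omega

/-- Every local construction comes from a Morse gradient with two critical simplices. -/
lemma exists_gradient [Finite τ] (hT : T.IsClosedTriangulation) :
    ∃ V : T.TwoCriticalMorseGradient,
      V.1.dualForest = c.baseTriangles ∧ V.1.edgeForest = c.criticalTree := by
  classical
  obtain ⟨r₃, depth₃, par₃, next₃, hpar₃, inj₃, ran₃⟩ := c.exists_rooted_base
  obtain ⟨r₀, depth₀, par₀, next₀, hpar₀, inj₀, ran₀⟩ := c.exists_rooted_criticalTree hT
  have par₀_mem : ∀ v, par₀ v ∈ c.criticalTree := fun v => ran₀ ▸ Set.mem_range_self v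
  have par₃_mem : ∀ t, par₃ t ∈ c.baseTriangles := fun t => ran₃ ▸ Set.mem_range_self t
  have d0 : ∀ v, (par₀ v).dim = 1 := fun v => (par₀_mem v).1
  have d3 : ∀ t, (par₃ t).dim = 2 := fun t => by
    obtain ⟨u, i, -, h⟩ := par₃_mem t
    rw [h, dim_mkTriangle]
  have d2 : ∀ s, (c.chosenTriangle s).dim = 2 := fun s => dim_mkTriangle _ _
  -- Each vertex flows towards the root of the critical tree. Each tetrahedron is entered through
  -- its parent triangle, so on tetrahedra the flow leaves the root.
  let P : Set (T.Simplex × T.Simplex) := {x | (∃ v, x = (v.1.1, par₀ v)) ∨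
    (∃ s, x = (c.chosenEdge s, c.chosenTriangle s)) ∨ ∃ t, x = (par₃ t, T.tet t.1)}
  have hP : ∀ a b, (a, b) ∈ P → (a.dim = 0 ∧ b.dim = 1 ∧ ∃ v, a = v.1.1 ∧ b = par₀ v) ∨
      (a.dim = 1 ∧ b.dim = 2 ∧ ∃ s, a = c.chosenEdge s ∧ b = c.chosenTriangle s) ∨
      (a.dim = 2 ∧ b.dim = 3 ∧ ∃ t, a = par₃ t ∧ b = T.tet t.1) := by
    rintro a b (⟨v, h⟩ | ⟨s, h⟩ | ⟨t, h⟩) <;> obtain ⟨rfl, rfl⟩ := Prod.mk.inj h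
    · exact Or.inl ⟨v.1.2, d0 v, v, rfl, rfl⟩
    · exact Or.inr (Or.inl ⟨c.dim_chosenEdge s, d2 s, s, rfl, rfl⟩)
    · exact Or.inr (Or.inr ⟨d3 t, rfl, t, rfl, rfl⟩)
  have hdisj : ∀ a b a' b', (a, b) ∈ P → (a', b') ∈ P →
      (a = a' ∨ a = b' ∨ b = a' ∨ b = b') → a = a' ∧ b = b' := by
    intro a b a' b' h h' hor
    have hdim : a.dim = a'.dim ∨ a.dim = b'.dim ∨ b.dim = a'.dim ∨ b.dim = b'.dim := by
      rcases hor with h | h | h | h <;> simp [h]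
    rcases hP _ _ h with ⟨h1, h2, v, e1, e2⟩ | ⟨h1, h2, s, e1, e2⟩ | ⟨h1, h2, t, e1, e2⟩ <;>
      rcases hP _ _ h' with ⟨h1', h2', v', e1', e2'⟩ | ⟨h1', h2', s', e1', e2'⟩ |
        ⟨h1', h2', t', e1', e2'⟩
    · suffices h : v = v' by rw [e1, e2, e1', e2', h]; exact ⟨rfl, rfl⟩
      rcases hor with h | h | h | h
      · exact Subtype.ext (Subtype.ext (e1.symm.trans (h.trans e1')))
      · rw [h] at h1; omega
      · rw [h] at h2; omega
      · exact inj₀ (e2.symm.trans (h.trans e2'))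
    · rcases hor with h | h | h | h
      · rw [h] at h1; omega
      · rw [h] at h1; omega
      · exact absurd (e1'.symm.trans (h.symm.trans e2)) ((par₀_mem v).2 s')
      · rw [h] at h2; omega
    · omega
    · rcases hor with h | h | h | h
      · rw [h] at h1; omega
      · exact absurd (e1.symm.trans (h.trans e2')) ((par₀_mem v').2 s)
      · rw [h] at h2; omega
      · rw [h] at h2; omega
    · suffices h : s = s' by rw [e1, e2, e1', e2', h]; exact ⟨rfl, rfl⟩
      rcases hor with h | h | h | h
      · exact c.chosenEdge_injective (e1.symm.trans (h.trans e1'))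
      · rw [h] at h1; omega
      · rw [h] at h2; omega
      · exact c.chosenTriangle_injective (e2.symm.trans (h.trans e2'))
    · rcases hor with h | h | h | h
      · rw [h] at h1; omega
      · rw [h] at h1; omega
      · refine absurd ?_ (c.chosenTriangle_not_mem s)
        rw [← e2, h, e1']; exact par₃_mem t'
      · rw [h] at h2; omega
    · omega
    · rcases hor with h | h | h | h
      · rw [h] at h1; omega
      · refine absurd ?_ (c.chosenTriangle_not_mem s')
        rw [← e2', ← h, e1]; exact par₃_mem t
      · rw [h] at h2; omega
      · rw [h] at h2; omega
    · suffices h : t = t' by rw [e1, e2, e1', e2', h]; exact ⟨rfl, rfl⟩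
      rcases hor with h | h | h | h
      · exact inj₃ (e1.symm.trans (h.trans e1'))
      · rw [h] at h1; omega
      · rw [h] at h2; omega
      · exact Subtype.ext (tet_injective (e2.symm.trans (h.trans e2')))
  let V : T.DiscreteVectorField :=
    { pairs := P
      isFacetOf := by
        intro a b h
        rcases hP _ _ h with ⟨-, -, v, rfl, rfl⟩ | ⟨-, -, s, rfl, rfl⟩ | ⟨-, -, t, rfl, rfl⟩
        · obtain ⟨-, t, a, b, hab, he, hv, -⟩ := (hpar₀ v).1
          rw [he, hv]
          exact isFacetOf_vert t hab
        · have hm := c.allowed s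
          exact isFacetOf_mkEdge _ hm.a_ne_b hm.a_ne_facet hm.b_ne_facet
        · obtain ⟨i, p, he, -⟩ := (hpar₃ t).1
          rw [he]
          exact isFacetOf_mkTriangle _ _
      disjoint := hdisj }
  have hedge : ∀ e : T.Simplex, e.dim = 1 → (∃ v, e = par₀ v) ∨ ∃ s, e = c.chosenEdge s := by
    intro e he
    by_cases h : ∃ s, e = c.chosenEdge s
    · exact Or.inr h
    · push Not at h
      have : e ∈ c.criticalTree := ⟨he, fun s => (h s).symm⟩
      rw [← ran₀] at this
      obtain ⟨v, rfl⟩ := this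
      exact Or.inl ⟨v, rfl⟩
  have htri : ∀ f : T.Simplex, f.dim = 2 → (∃ t, f = par₃ t) ∨ ∃ s, f = c.chosenTriangle s := by
    intro f hf
    rcases c.triangle_cases hT hf with h | h
    · rw [← ran₃] at h
      obtain ⟨t, rfl⟩ := h
      exact Or.inl ⟨t, rfl⟩
    · exact Or.inr h
  have hcrit : V.critical = {r₀.1, T.tet r₃} := by
    ext x
    rw [DiscreteVectorField.mem_critical_iff]
    constructor
    · intro h
      rcases simplex_cases x with ⟨t, a, rfl⟩ | ⟨t, a, b, hab, rfl⟩ | ⟨t, i, rfl⟩ | ⟨t, rfl⟩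
      · by_contra hn
        have hne : (⟨T.vert t a, rfl⟩ : {v : T.Simplex // v.dim = 0}) ∉ ({r₀} : Set _) :=
          fun e => hn (Or.inl (congrArg Subtype.val (Set.mem_singleton_iff.1 e)))
        exact (h (par₀ ⟨_, hne⟩)).1 (Or.inl ⟨⟨_, hne⟩, rfl⟩)
      · rcases hedge _ (dim_mkEdge t hab) with ⟨v, e⟩ | ⟨s, e⟩
        · exact absurd (Or.inl ⟨v, by rw [e]⟩) (h v.1.1).2
        · exact absurd (Or.inr (Or.inl ⟨s, by rw [e]⟩)) (h (c.chosenTriangle s)).1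
      · rcases htri _ (dim_mkTriangle t i) with ⟨v, e⟩ | ⟨s, e⟩
        · exact absurd (Or.inr (Or.inr ⟨v, by rw [e]⟩)) (h (T.tet v.1)).1
        · exact absurd (Or.inr (Or.inl ⟨s, by rw [e]⟩)) (h (c.chosenEdge s)).2
      · by_contra hn
        refine (h (par₃ ⟨t, fun e => hn (Or.inr ?_)⟩)).2 (Or.inr (Or.inr ⟨_, rfl⟩))
        rw [Set.mem_singleton_iff.1 e]; rfl
    · rintro (rfl | rfl) y
      · have h0 := r₀.2
        constructor
        · intro h
          rcases hP _ _ h with ⟨-, -, v, e1, -⟩ | ⟨h1, -⟩ | ⟨h1, -⟩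
          · exact v.2 (Subtype.ext e1.symm)
          all_goals omega
        · intro h
          rcases hP _ _ h with ⟨-, h1, -⟩ | ⟨-, h1, -⟩ | ⟨-, h1, -⟩ <;> omega
      · have h0 := dim_tet (G := T) r₃
        constructor
        · intro h
          rcases hP _ _ h with ⟨h1, -⟩ | ⟨h1, -⟩ | ⟨h1, -⟩ <;> omega
        · intro h
          rcases hP _ _ h with ⟨-, h1, -⟩ | ⟨-, h1, -⟩ | ⟨-, -, t, -, e⟩
          · omega
          · omega
          · exact t.2 (tet_injective e).symm
  have hncard : V.critical.ncard = 2 := by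
    rw [hcrit, Set.ncard_pair]
    intro h
    have := r₀.2
    rw [h] at this
    simp at this
  -- A discrete Morse function: it decreases along all steps.
  obtain ⟨B, hB⟩ := (Set.finite_range depth₀).bddAbove
  obtain ⟨D, hD⟩ := (Set.finite_range depth₃).bddAbove
  replace hB : ∀ v, depth₀ v ≤ B := fun v => hB (Set.mem_range_self v)
  replace hD : ∀ t, depth₃ t ≤ D := fun t => hD (Set.mem_range_self t)
  -- Three bands of values: vertices and critical edges up to `2 * B`, then chosen edges and
  -- triangles, then tree triangles and tetrahedra. In the middle band each edge is just above its
  -- triangle and later steps lie lower, since a glued triangle contains only chosen edges of the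
  -- same or later steps. In the top band a parent triangle lies strictly between its child and its
  -- parent tetrahedron. The default values 0 of `Function.extend` are never taken, because every
  -- simplex is listed.
  let φ : T.Simplex → ℕ := fun x =>
    if h : x.dim = 0 then 2 * depth₀ ⟨x, h⟩
    else if x.dim = 1 then Function.extend par₀ (fun v => 2 * depth₀ v.1 - 1)
      (Function.extend c.chosenEdge (fun s => 2 * B + 2 * (c.numSteps - s) + 2) 0) x
    else if x.dim = 2 then
      Function.extend par₃ (fun t => 2 * B + 2 * c.numSteps + 5 + 2 * (D - depth₃ t.1))
      (Function.extend c.chosenTriangle (fun s => 2 * B + 2 * (c.numSteps - s) + 1) 0) x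
    else Function.extend T.tet (fun t => 2 * B + 2 * c.numSteps + 4 + 2 * (D - depth₃ t)) 0 x
  have φ_vert : ∀ v, φ v.1 = 2 * depth₀ v := fun v => dif_pos v.2
  have φ_par₀ : ∀ v, φ (par₀ v) = 2 * depth₀ v.1 - 1 := by
    intro v
    simp only [φ, d0, one_ne_zero, dif_neg, not_false_eq_true, if_true]
    exact inj₀.extend_apply _ _ _
  have φ_edge : ∀ s, φ (c.chosenEdge s) = 2 * B + 2 * (c.numSteps - s) + 2 := by
    intro s
    simp only [φ, c.dim_chosenEdge, one_ne_zero, dif_neg, not_false_eq_true, if_true]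
    rw [Function.extend_apply']
    · exact c.chosenEdge_injective.extend_apply _ _ _
    · rintro ⟨v, h⟩
      exact (par₀_mem v).2 s h.symm
  have φ_par₃ : ∀ t, φ (par₃ t) = 2 * B + 2 * c.numSteps + 5 + 2 * (D - depth₃ t.1) := by
    intro t
    simp only [φ, d3, OfNat.ofNat_ne_zero, OfNat.ofNat_ne_one, dif_neg, not_false_eq_true,
      if_true, if_false]
    exact inj₃.extend_apply _ _ _
  have φ_tri : ∀ s, φ (c.chosenTriangle s) = 2 * B + 2 * (c.numSteps - s) + 1 := by
    intro s
    simp only [φ, d2, OfNat.ofNat_ne_zero, OfNat.ofNat_ne_one, dif_neg, not_false_eq_true,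
      if_true, if_false]
    rw [Function.extend_apply']
    · exact c.chosenTriangle_injective.extend_apply _ _ _
    · rintro ⟨t, h⟩
      exact c.chosenTriangle_not_mem s (h ▸ par₃_mem t)
  have φ_tet : ∀ t, φ (T.tet t) = 2 * B + 2 * c.numSteps + 4 + 2 * (D - depth₃ t) := by
    intro t
    simp only [φ, dim_tet, OfNat.ofNat_ne_zero, OfNat.ofNat_ne_one, dif_neg, not_false_eq_true,
      if_false, (by decide : ¬ (3 = 2))]
    exact tet_injective.extend_apply _ _ _
  have hstep : ∀ x y, V.Step x y → φ y < φ x := by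
    rintro x y (h | h)
    · rcases hP _ _ h with ⟨-, -, v, rfl, rfl⟩ | ⟨-, -, s, rfl, rfl⟩ | ⟨-, -, t, rfl, rfl⟩
      · have := (hpar₀ v).2
        rw [φ_vert, φ_par₀]; omega
      · rw [φ_edge, φ_tri]; omega
      · rw [φ_par₃, φ_tet]; omega
    · rcases h.cases with ⟨t, i, rfl, rfl, h⟩ | ⟨t, i, a, b, hab, ha, hb, rfl, rfl, h⟩ |
        ⟨t, a, b, hab, rfl, rfl, h⟩
      · rcases htri _ (dim_mkTriangle t i) with ⟨u, e⟩ | ⟨s, e⟩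
        · obtain ⟨hu, hlt⟩ := hpar₃ u
          have hm : T.mkTriangle t i ∈ c.baseTriangles := e ▸ par₃_mem u
          obtain ⟨w, p, hg⟩ := hT.exists_glue t i
          have hb := (c.base_glue hm).trans hg
          rcases hu.unique (e ▸ ⟨i, p, rfl, hb⟩ : c.DualInc (par₃ u) t w) with ⟨h1, -⟩ | ⟨h1, -⟩
          -- Leaving a tetrahedron through its own parent triangle needs a second occurrence of that
          -- triangle, which would be a loop of the base tree.
          · obtain ⟨j, hj, e'⟩ := h (Or.inr (Or.inr ⟨u, by rw [e, h1]⟩))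
            rcases mkTriangle_eq_iff.1 e' with ⟨-, h2⟩ | ⟨q, hq, -⟩
            · exact absurd h2 hj
            · exact absurd ((c.base_glue hm).trans hq) (c.base_tree.no_loop _ _ _)
          · rw [e, φ_par₃, φ_tet, h1]
            have := hD u.1
            omega
        · rw [e, φ_tri, φ_tet]; omega
      · rcases hedge _ (dim_mkEdge t hab) with ⟨v, e⟩ | ⟨r, e⟩ <;>
          rcases htri _ (dim_mkTriangle t i) with ⟨u, e'⟩ | ⟨s, e'⟩
        · have := hB v.1
          rw [e, e', φ_par₀, φ_par₃]; omega
        · have := hB v.1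
          rw [e, e', φ_par₀, φ_tri]; omega
        · rw [e, e', φ_edge, φ_par₃]; omega
        · rcases (c.le_of_chosenEdge ha hb e e').lt_or_eq with hlt | rfl
          · have h1 : (s : ℕ) < r := hlt
            have h2 := r.2
            rw [e, e', φ_edge, φ_tri]; omega
          -- Going back from a triangle to its own chosen edge needs a second occurrence, and there
          -- is none.
          · obtain ⟨k, l, -, hk, hl, hne, e''⟩ := h (Or.inr (Or.inl ⟨s, by rw [e, e']⟩))
            exact absurd (c.pair_eq_of_chosenEdge hk hl ha hb (e''.symm.trans e) e e') hne
      · rcases hedge _ (dim_mkEdge t hab) with ⟨v, e⟩ | ⟨r, e⟩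
        · obtain ⟨hv, hlt⟩ := hpar₀ v
          rcases hv.ends e.symm with ⟨h1, h2⟩ | ⟨h1, -⟩
          · have h3 : v.1.1 = (next₀ v).1 := by
              rw [← h1, ← h2]
              exact h (Or.inl ⟨v, by rw [e, h1]⟩)
            rw [← Subtype.ext h3] at hlt
            exact absurd hlt (lt_irrefl _)
          · rw [e, h1, φ_vert, φ_par₀]; omega
        · have := hB ⟨T.vert t a, rfl⟩
          have h1 := φ_vert ⟨T.vert t a, rfl⟩
          simp only at h1
          rw [e, φ_edge, h1]; omega
  have hacyc : V.IsAcyclic := by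
    have key : ∀ x y, TransGen V.Step x y → φ y < φ x := by
      intro x y h
      induction h with
      | single h => exact hstep _ _ h
      | tail _ h ih => exact (hstep _ _ h).trans ih
    exact fun x h => lt_irrefl _ (key _ _ h)
  refine ⟨⟨V, hacyc, hncard⟩, ?_, ?_⟩
  · ext f
    constructor
    · rintro ⟨hd, t, h⟩
      rcases hP _ _ h with ⟨h1, -⟩ | ⟨h1, -⟩ | ⟨-, -, t, rfl, -⟩
      · omega
      · omega
      · exact par₃_mem t
    · intro hf
      rw [← ran₃] at hf
      obtain ⟨t, rfl⟩ := hf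
      exact ⟨d3 t, _, Or.inr (Or.inr ⟨t, rfl⟩)⟩
  · ext e
    constructor
    · rintro ⟨hd, v, h⟩
      rcases hP _ _ h with ⟨-, -, v, -, rfl⟩ | ⟨-, h1, -⟩ | ⟨-, h1, -⟩
      · exact par₀_mem v
      · omega
      · omega
    · intro he
      rw [← ran₀] at he
      obtain ⟨v, rfl⟩ := he
      exact ⟨d0 v, _, Or.inl ⟨v, rfl⟩⟩

end LocalConstruction

end Gluing

/-! ### The bijection -/

theorem mainTheorem6 {τ : Type*} [Finite τ] (T : Gluing τ) (hT : T.IsClosedTriangulation) :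
    ∃ Φ : Quotient T.repointing ≃ Quotient T.weakEquivalence,
      ∀ (V : T.TwoCriticalMorseGradient) (c : T.LocalConstruction),
        (Φ (Quotient.mk T.repointing V) = Quotient.mk T.weakEquivalence c ↔
          V.1.dualForest = c.baseTriangles ∧ V.1.edgeForest = c.criticalTree) ∧
        (Φ (Quotient.mk T.repointing V) = Quotient.mk T.weakEquivalence c →
          V.1.middlePairs = Set.range (fun s => (c.chosenEdge s, c.chosenTriangle s))) := by
  choose f hf using fun V : T.TwoCriticalMorseGradient =>
    Gluing.DiscreteVectorField.exists_localConstruction hT V.2.1 V.2.2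
  have hbase : ∀ c c' : T.LocalConstruction, c.baseTriangles = c'.baseTriangles →
      c.base = c'.base := fun c c' h => by
    rw [c.base_eq_restrict, c'.base_eq_restrict, h]
  have hbase' : ∀ c c' : T.LocalConstruction, c.base = c'.base →
      c.baseTriangles = c'.baseTriangles := fun c c' h => by
    unfold Gluing.LocalConstruction.baseTriangles
    rw [h]
  have hiff : ∀ V c, Quotient.mk T.weakEquivalence (f V) = Quotient.mk T.weakEquivalence c ↔
      V.1.dualForest = c.baseTriangles ∧ V.1.edgeForest = c.criticalTree := by
    intro V c
    rw [Quotient.eq]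
    constructor
    · rintro ⟨h1, h2⟩
      exact ⟨(hf V).1.trans (hbase' _ _ h1), (hf V).2.1.trans h2⟩
    · rintro ⟨h1, h2⟩
      exact ⟨hbase _ _ ((hf V).1.symm.trans h1), (hf V).2.1.symm.trans h2⟩
  -- By `hiff` the class of `f V` depends only on the two forests of `V`, not on the chosen
  -- enumeration or coordinates.
  let F : Quotient T.repointing → Quotient T.weakEquivalence :=
    Quotient.lift (fun V => Quotient.mk _ (f V)) fun V W h => (hiff V (f W)).2
      ⟨h.2.1.trans (hf W).1, h.1.trans (hf W).2.1⟩
  have hF : Function.Bijective F := by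
    constructor
    · intro x y
      induction x using Quotient.inductionOn with
      | h V =>
      induction y using Quotient.inductionOn with
      | h W =>
        intro h
        have h1 := (hiff V (f W)).1 h
        refine Quotient.sound ⟨h1.2.trans (hf W).2.1.symm, h1.1.trans (hf W).1.symm, ?_⟩
        -- Re-pointing also demands equal middle pairs; these are recovered from the forests by
        -- triangularity.
        rw [(f W).middlePairs_eq hT V.2.1 V.2.2 h1.1 h1.2, (hf W).2.2]
    · intro y
      induction y using Quotient.inductionOn with
      | h c =>
        obtain ⟨V, hV⟩ := c.exists_gradient hT
        exact ⟨Quotient.mk _ V, (hiff V c).2 hV⟩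
  refine ⟨Equiv.ofBijective F hF, fun V c => ⟨hiff V c, fun h => ?_⟩⟩
  have h1 := (hiff V c).1 h
  exact c.middlePairs_eq hT V.2.1 V.2.2 h1.1 h1.2
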